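/- **Setting.** Let $n,q,K\ge 1$, $J\ge 0$, and let $X\in\mathbb R^{n\times q}$ be a random matrix with independent rows $X_i\sim\mathcal N(\mu_i,\sigma^2I_q)$, where $\mu\in\mathbb R^{n\times q}$ and $\sigma>0$ are unknown. For $A\in\mathbb R^{n\times q}$ let $\mathcal C(A)=(c^{(0)}(A),\dots,c^{(J)}(A))$, with $c^{(j)}(A):[n]\to[K]$, denote the outcome of Lloyd's $K$-means algorithm run for $J$ iterations on the rows of $A$. That is, $c_i^{(0)}(A)$ is the index of the initial center nearest to $A_i$ in Euclidean distance, where the initial centers $m^{(0)}_1(A),\dots,m^{(0)}_K(A)\in\mathbb R^q$ are a given measurable function of $A$ (for example, rows of $A$ with pre-specified indices). For $1\le j\le J$, $c_i^{(j)}(A)$ is the index of the nearest among the means of the $K$ clusters defined by $c^{(j-1)}(A)$ (an empty cluster is given the center $0$). Ties go to the smallest index. Let $\mathcal C_k=\{i\in[n]: c_i^{(J)}(X)=k\}$ be the final clusters of $X$. Let $\mathcal V\subseteq\{(k,k'):k<k'\in[K]\}$ be pre-specified (non-random), and let $\mathcal K$ be the set of indices $k\in[K]$ that occur in some pair of $\mathcal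 V$. Put $$\mathbf v_{k,k'}=\frac{\mathbf 1_{\mathcal C_k}}{|\mathcal C_k|}-\frac{\mathbf 1_{\mathcal C_{k'}}}{|\mathcal C_{k'}|}\in\mathbb R^n,\quad \mathcal E=\mathrm{span}\{\mathbf v_{k,k'}:(k,k')\in\mathcal V\},\quad P_1=\sum_{k\in\mathcal K}\Big(I_{\mathcal C_k}-\frac{\mathbf 1_{\mathcal C_k}\mathbf 1_{\mathcal C_k}^\top}{|\mathcal C_k|}\Big),$$ where $I_{\mathcal C_k}$ is the diagonal matrix with diagonal $\mathbf 1_{\mathcal C_k}$. Let $P_{\mathcal E}$ be the orthogonal projection matrix onto $\mathcal E$, and let $$P_2=I_n-P_{\mathcal E}-P_1,\quad d=q\dim\mathcal E,\quad d^*=q\Big(\sum_{k\in\mathcal K}|\mathcal C_k|-|\mathcal K|\Big),\quad r^*=d^*/d.$$ With $\|\cdot\|_F$ the Frobenius norm, let $$T^*=\frac{\|P_{\mathcal E}X\|_F^2/d}{\|P_1X\|_F^2/d^*},\qquad Z^*=\Big(\frac{P_{\mathcal E}X}{\|P_{\mathcal E}X\|_F},\ \frac{P_1X}{\|P_1X\|_F},\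 \|P_{\mathcal E}X\|_F^2+\|P_1X\|_F^2,\ P_2X\Big),$$ $$x^*(\psi)=\sqrt{\|P_{\mathcal E}X\|_F^2+\|P_1X\|_F^2}\Big(\sqrt{\tfrac{\psi}{\psi+r^*}}\,\tfrac{P_{\mathcal E}X}{\|P_{\mathcal E}X\|_F}+\sqrt{\tfrac{r^*}{\psi+r^*}}\,\tfrac{P_1X}{\|P_1X\|_F}\Big)+P_2X,\qquad \mathcal S^*=\{\psi\ge 0:\mathcal C(X)=\mathcal C(x^*(\psi))\}.$$ Let $Q^*$ be the conditional distribution function of $T^*$ given $(\mathcal C(X),Z^*)$, and let $p^*=1-Q^*(T^*)$. The null hypothesis $H^*_{0,\mathcal V}$, which depends on the clusters, states that $\mu_i=\mu_{i'}$ for all $i,i'\in\mathcal C_k\cup\mathcal C_{k'}$ and all $(k,k')\in\mathcal V$. Call an outcome *testable* if its final clusters $\mathcal C_k$, $k\in\mathcal K$, are all nonempty and at least one of them has at least two elements (so that $d,d^*>0$ and $T^*$ is defined). **Theorem.** 1. Almost surely on the event that $\mathcal C(X)$ is testable and $H^*_{0,\mathcal V}$ holds for the clusters of $\mathcal C(X)$,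 the conditional law of $T^*$ given $(\mathcal C(X),Z^*)$ is the $F_{d,d^*}$ distribution truncated to $\mathcal S^*$ (that is, $F_{d,d^*}$ conditioned on $\mathcal S^*$). 2. For every testable outcome $C$ with $\mathbb P(\mathcal C(X)=C)>0$ for whose clusters $H^*_{0,\mathcal V}$ holds, $p^*$ is uniformly distributed on $[0,1]$ conditionally on $\mathcal C(X)=C$. In particular, $\mathbb P(p^*\le\alpha\mid\mathcal C(X)=C)=\alpha$ for all $\alpha\in[0,1]$. -/

import Mathlib

open MeasureTheory ProbabilityTheory
open scoped Matrix Matrix.Norms.Frobenius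

/-- The product (Borel) σ-algebra on real matrices. -/
instance Matrix.instMeasurableSpaceReal {m n : Type*} : MeasurableSpace (Matrix m n ℝ) :=
  inferInstanceAs (MeasurableSpace (m → n → ℝ))

noncomputable section

namespace ClusterInference

/-! ### The `K`-means algorithm (Lloyd's algorithm) -/

section KMeans

variable {n q K : ℕ}

/-- The indices of the rows of `m` (the centers) that are nearest to `x` in Euclidean distance. -/
def nearestSet (m : Matrix (Fin K) (Fin q) ℝ) (x : Fin q → ℝ) : Finset (Fin K) :=
  Finset.univ.filter fun l => ∀ l', ‖WithLp.toLp 2 (x - m l)‖ ≤ ‖WithLp.toLp 2 (x - m l')‖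

theorem nearestSet_nonempty [NeZero K] (m : Matrix (Fin K) (Fin q) ℝ) (x : Fin q → ℝ) :
    (nearestSet m x).Nonempty := by
  obtain ⟨l, hl⟩ := Finite.exists_min fun l : Fin K => ‖WithLp.toLp 2 (x - m l)‖
  exact ⟨l, Finset.mem_filter.2 ⟨Finset.mem_univ l, hl⟩⟩

/-- The index of the nearest center; ties are resolved in favour of the smallest index. -/
def nearest [NeZero K] (m : Matrix (Fin K) (Fin q) ℝ) (x : Fin q → ℝ) : Fin K :=
  (nearestSet m x).min' (nearestSet_nonempty m x)

/-- `cluster c k` is the set `𝒞_k` of indices that the assignment `c` puts in the `k`th cluster. -/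
def cluster (c : Fin n → Fin K) (k : Fin K) : Finset (Fin n) :=
  Finset.univ.filter fun i => c i = k

/-- The matrix whose `l`th row is the mean of the rows of `A` in the `l`th cluster of `c`
(zero for an empty cluster). -/
def centers (A : Matrix (Fin n) (Fin q) ℝ) (c : Fin n → Fin K) : Matrix (Fin K) (Fin q) ℝ :=
  Matrix.of fun l => ((cluster c l).card : ℝ)⁻¹ • ∑ i ∈ cluster c l, A i

/-- The cluster assignment in the `j`th iteration of `K`-means run on the rows of `A`, where
`init A` holds the initial centers. -/
def kmeansIter [NeZero K] (init : Matrix (Fin n) (Fin q) ℝ → Matrix (Fin K) (Fin q) ℝ)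
    (A : Matrix (Fin n) (Fin q) ℝ) : ℕ → Fin n → Fin K
  | 0 => fun i => nearest (init A) (A i)
  | j + 1 => fun i => nearest (centers A (kmeansIter init A j)) (A i)

/-- The outcome `𝒞(A)` of `K`-means run for `J` iterations: the cluster assignments in
the initialization step and in every iteration. -/
def kmeans [NeZero K] (init : Matrix (Fin n) (Fin q) ℝ → Matrix (Fin K) (Fin q) ℝ) (J : ℕ)
    (A : Matrix (Fin n) (Fin q) ℝ) : Fin (J + 1) → Fin n → Fin K :=
  fun j => kmeansIter init A j

/-- The final cluster assignment of an outcome; it defines the clusters `𝒞_1, …, 𝒞_K`. -/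
def final {J : ℕ} (C : Fin (J + 1) → Fin n → Fin K) : Fin n → Fin K := C (Fin.last J)

end KMeans

/-! ### Null hypothesis, projections and test statistic, for an assignment `c` -/

section Statistic

variable {n q K : ℕ}

/-- The set `𝒦` of the indices of all clusters of interest. -/
def interest (V : Finset (Fin K × Fin K)) : Finset (Fin K) :=
  Finset.univ.filter fun k => ∃ k', (k, k') ∈ V ∨ (k', k) ∈ V

/-- The null hypothesis `H*_{0,V}`: `μ_i = μ_{i'}` for all `i, i' ∈ 𝒞_k ∪ 𝒞_{k'}`, `(k, k') ∈ V`. -/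
def NullHyp (μ : Matrix (Fin n) (Fin q) ℝ) (V : Finset (Fin K × Fin K)) (c : Fin n → Fin K) :
    Prop :=
  ∀ p ∈ V, ∀ i ∈ cluster c p.1 ∪ cluster c p.2, ∀ i' ∈ cluster c p.1 ∪ cluster c p.2, μ i = μ i'

/-- The clusters of interest are nonempty, and they are not all singletons, so that the test
statistic is defined. -/
def Testable (V : Finset (Fin K × Fin K)) (c : Fin n → Fin K) : Prop :=
  (∀ k ∈ interest V, (cluster c k).Nonempty) ∧ ∃ k ∈ interest V, 2 ≤ (cluster c k).card

/-- The indicator vector `𝟏_{𝒞_k}`. -/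
def indVec (c : Fin n → Fin K) (k : Fin K) : Fin n → ℝ := fun i => if c i = k then 1 else 0

/-- `v_{k,k'} = 𝟏_{𝒞_k} / |𝒞_k| - 𝟏_{𝒞_{k'}} / |𝒞_{k'}|`. -/
def contrast (c : Fin n → Fin K) (k k' : Fin K) : EuclideanSpace ℝ (Fin n) :=
  WithLp.toLp 2 (((cluster c k).card : ℝ)⁻¹ • indVec c k
    - ((cluster c k').card : ℝ)⁻¹ • indVec c k')

/-- The space `ℰ = span {v_{k,k'} : (k, k') ∈ V}`. -/
def contrastSpace (V : Finset (Fin K × Fin K)) (c : Fin n → Fin K) :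
    Submodule ℝ (EuclideanSpace ℝ (Fin n)) :=
  Submodule.span ℝ ((fun p : Fin K × Fin K => contrast c p.1 p.2) '' (V : Set (Fin K × Fin K)))

/-- The matrix `P_ℰ` of the orthogonal projection onto `ℰ`. -/
def PE (V : Finset (Fin K × Fin K)) (c : Fin n → Fin K) : Matrix (Fin n) (Fin n) ℝ :=
  (Matrix.toEuclideanCLM (n := Fin n) (𝕜 := ℝ)).symm (contrastSpace V c).starProjection

/-- `P_1 = ∑_{k ∈ 𝒦} (I_{𝒞_k} - 𝟏_{𝒞_k} 𝟏_{𝒞_k}ᵀ / |𝒞_k|)`. -/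
def P1 (V : Finset (Fin K × Fin K)) (c : Fin n → Fin K) : Matrix (Fin n) (Fin n) ℝ :=
  ∑ k ∈ interest V, (Matrix.diagonal (indVec c k)
    - ((cluster c k).card : ℝ)⁻¹ • Matrix.vecMulVec (indVec c k) (indVec c k))

/-- `P_2 = I_n - P_ℰ - P_1`. -/
def P2 (V : Finset (Fin K × Fin K)) (c : Fin n → Fin K) : Matrix (Fin n) (Fin n) ℝ :=
  1 - PE V c - P1 V c

/-- `d = q · dim ℰ`. -/
def df (q : ℕ) (V : Finset (Fin K × Fin K)) (c : Fin n → Fin K) : ℝ :=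
  q * Module.finrank ℝ (contrastSpace V c)

/-- `d* = q (∑_{k ∈ 𝒦} |𝒞_k| - |𝒦|)`. -/
def dfStar (q : ℕ) (V : Finset (Fin K × Fin K)) (c : Fin n → Fin K) : ℝ :=
  q * ((∑ k ∈ interest V, ((cluster c k).card : ℝ)) - (interest V).card)

/-- The test statistic `T* = (‖P_ℰ A‖_F² / d) / (‖P_1 A‖_F² / d*)`. -/
def Tstar (V : Finset (Fin K × Fin K)) (c : Fin n → Fin K) (A : Matrix (Fin n) (Fin q) ℝ) : ℝ :=
  (‖PE V c * A‖ ^ 2 / df q V c) / (‖P1 V c * A‖ ^ 2 / dfStar q V c)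

/-- `Z* = (P_ℰ A / ‖P_ℰ A‖_F, P_1 A / ‖P_1 A‖_F, ‖P_ℰ A‖_F² + ‖P_1 A‖_F², P_2 A)`. -/
def Zstar (V : Finset (Fin K × Fin K)) (c : Fin n → Fin K) (A : Matrix (Fin n) (Fin q) ℝ) :
    Matrix (Fin n) (Fin q) ℝ × Matrix (Fin n) (Fin q) ℝ × ℝ × Matrix (Fin n) (Fin q) ℝ :=
  (‖PE V c * A‖⁻¹ • (PE V c * A), ‖P1 V c * A‖⁻¹ • (P1 V c * A),
    ‖PE V c * A‖ ^ 2 + ‖P1 V c * A‖ ^ 2, P2 V c * A)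

/-- The perturbed data `x*(ψ)`, with `r* = d* / d`. -/
def xstar (V : Finset (Fin K × Fin K)) (c : Fin n → Fin K) (A : Matrix (Fin n) (Fin q) ℝ)
    (ψ : ℝ) : Matrix (Fin n) (Fin q) ℝ :=
  let r : ℝ := dfStar q V c / df q V c
  √(‖PE V c * A‖ ^ 2 + ‖P1 V c * A‖ ^ 2) •
      (√(ψ / (ψ + r)) • (‖PE V c * A‖⁻¹ • (PE V c * A))
        + √(r / (ψ + r)) • (‖P1 V c * A‖⁻¹ • (P1 V c * A)))
    + P2 V c * A

/-- The truncation set `S* = {ψ ≥ 0 : 𝒞(A) = 𝒞(x*(ψ))}`. -/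
def Sstar [NeZero K] (init : Matrix (Fin n) (Fin q) ℝ → Matrix (Fin K) (Fin q) ℝ) (J : ℕ)
    (V : Finset (Fin K × Fin K)) (A : Matrix (Fin n) (Fin q) ℝ) : Set ℝ :=
  {ψ | 0 ≤ ψ ∧ kmeans init J A = kmeans init J (xstar V (final (kmeans init J A)) A ψ)}

end Statistic

/-! ### Distributions -/

/-- The chi-squared distribution with `d` degrees of freedom, `Gamma(d / 2, 1 / 2)`. -/
def chiSquared (d : ℝ) : Measure ℝ := gammaMeasure (d / 2) (1 / 2)

/-- The `F_{d₁,d₂}` distribution: the law of `(U₁ / d₁) / (U₂ / d₂)` for independent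
`U₁ ∼ χ²_{d₁}` and `U₂ ∼ χ²_{d₂}`. -/
def FDist (d₁ d₂ : ℝ) : Measure ℝ :=
  ((chiSquared d₁).prod (chiSquared d₂)).map fun u => (u.1 / d₁) / (u.2 / d₂)

/-! ### Conditional distribution and p-value, for random data `X` -/

section PValue

variable {Ω : Type*} [MeasurableSpace Ω] {n q K : ℕ} [NeZero K]

/-- The test statistic `T*` of the data, with the clusters estimated from the data. -/
def TstarRV (init : Matrix (Fin n) (Fin q) ℝ → Matrix (Fin K) (Fin q) ℝ) (J : ℕ)
    (V : Finset (Fin K × Fin K)) (X : Ω → Matrix (Fin n) (Fin q) ℝ) (ω : Ω) : ℝ :=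
  Tstar V (final (kmeans init J (X ω))) (X ω)

/-- The pair `(𝒞(X), Z*)` on which one conditions. -/
def condRV (init : Matrix (Fin n) (Fin q) ℝ → Matrix (Fin K) (Fin q) ℝ) (J : ℕ)
    (V : Finset (Fin K × Fin K)) (X : Ω → Matrix (Fin n) (Fin q) ℝ) (ω : Ω) :
    (Fin (J + 1) → Fin n → Fin K) ×
      (Matrix (Fin n) (Fin q) ℝ × Matrix (Fin n) (Fin q) ℝ × ℝ × Matrix (Fin n) (Fin q) ℝ) :=
  (kmeans init J (X ω), Zstar V (final (kmeans init J (X ω))) (X ω))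

/-- The regular conditional law of `T*` given `(𝒞(X), Z*)`, at the observed value of the latter. -/
def condLaw (P : Measure Ω) [IsProbabilityMeasure P]
    (init : Matrix (Fin n) (Fin q) ℝ → Matrix (Fin K) (Fin q) ℝ) (J : ℕ)
    (V : Finset (Fin K × Fin K)) (X : Ω → Matrix (Fin n) (Fin q) ℝ) (ω : Ω) : Measure ℝ :=
  condDistrib (TstarRV init J V X) (condRV init J V X) P (condRV init J V X ω)

/-- The selective p-value `p* = 1 - Q*(T*)`, where `Q*` is the conditional distribution function
of `T*` given `(𝒞(X), Z*)`. -/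
def pstar (P : Measure Ω) [IsProbabilityMeasure P]
    (init : Matrix (Fin n) (Fin q) ℝ → Matrix (Fin K) (Fin q) ℝ) (J : ℕ)
    (V : Finset (Fin K × Fin K)) (X : Ω → Matrix (Fin n) (Fin q) ℝ) (ω : Ω) : ℝ :=
  1 - cdf (condLaw P init J V X ω) (TstarRV init J V X ω)

end PValue

end ClusterInference

end

open ClusterInference

/-! Fix a testable outcome `C` whose clusters satisfy the null hypothesis, and freeze these clusters
in the definitions of `T*` and `Z*`. The matrices `PE` and `P1` are then deterministic orthogonal
projections with product zero. Both annihilate `μ`: it is constant on each cluster of interest, and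
the cluster means that a contrast compares agree. So `P_ℰ X`, `P_1 X` and `P_2 X` are independent,
and the first two are centred isotropic Gaussians on spaces of dimensions `d` and `d*`. In each of
these, length is independent of direction; the ratio of the squared lengths is moreover independent
of their sum. Hence the frozen `T*` is `F`-distributed and independent of the frozen `Z*`
(`stdGaussian_map_FRatio`, `map_Zstar_Tstar`).

Almost surely `X` is recovered from the frozen pair, as `X = x*(T*)` (`xstar_Tstar`). Thus `𝒞(X) =
C` is the event that `T*` lies in a set determined by `Z*`, and conditioning an independent `T*` on
it merely truncates the `F` law (`condDistrib_of_selection`). On that event the frozen and the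
data-driven statistics coincide, which gives the first claim.

For the second, the `F` law and hence its truncation have no atoms, so the probability integral
transform makes `p*` uniform given `(𝒞(X), Z*)`. Integrating over `Z*` leaves it uniform given `𝒞(X)
= C` (`map_cond_one_sub_cdf`). -/

open scoped ENNReal

/-! ### Ratio and sum of independent gamma variables. -/

section Gamma

theorem setLIntegral_Ioi_comp_mul {c : ℝ} (hc : 0 < c) (f : ℝ → ℝ≥0∞) :
    ∫⁻ t in Set.Ioi 0, ENNReal.ofReal c * f (c * t) = ∫⁻ a in Set.Ioi 0, f a := by
  have himg : (fun t : ℝ => c * t) '' Set.Ioi 0 = Set.Ioi 0 := by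
    rw [Set.image_mul_left_Ioi hc, mul_zero]
  have h := lintegral_image_eq_lintegral_abs_deriv_mul (s := Set.Ioi (0 : ℝ))
    (f := fun t => c * t) (f' := fun _ => c) measurableSet_Ioi
    (fun x _ => by simpa using ((hasDerivAt_id x).const_mul c).hasDerivWithinAt)
    (fun x _ y _ hxy => mul_left_cancel₀ hc.ne' hxy) f
  rw [himg, abs_of_pos hc] at h
  exact h.symm

theorem setLIntegral_Ioi_comp_sq (f : ℝ → ℝ≥0∞) :
    ∫⁻ t in Set.Ioi 0, ENNReal.ofReal (2 * t) * f (t ^ 2) = ∫⁻ a in Set.Ioi 0, f a := by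
  have himg : (fun t : ℝ => t ^ 2) '' Set.Ioi 0 = Set.Ioi 0 := by
    ext x
    constructor
    · rintro ⟨t, ht, rfl⟩
      exact pow_pos (Set.mem_Ioi.1 ht) 2
    · intro hx
      exact ⟨√x, Real.sqrt_pos.2 hx, Real.sq_sqrt (le_of_lt hx)⟩
  have h := lintegral_image_eq_lintegral_abs_deriv_mul (s := Set.Ioi (0 : ℝ))
    (f := fun t => t ^ 2) (f' := fun t => 2 * t) measurableSet_Ioi
    (fun x _ => by simpa using (hasDerivAt_pow 2 x).hasDerivWithinAt)
    (fun x hx y hy hxy => (pow_left_inj₀ (le_of_lt hx) (le_of_lt hy) two_ne_zero).1 hxy) f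
  rw [himg] at h
  rw [h]
  refine setLIntegral_congr_fun measurableSet_Ioi fun t ht => ?_
  rw [abs_of_pos (mul_pos two_pos (Set.mem_Ioi.1 ht))]

theorem lintegral_gammaMeasure (a r : ℝ) {f : ℝ → ℝ≥0∞} (hf : Measurable f) :
    ∫⁻ x, f x ∂(gammaMeasure a r) =
      ∫⁻ x in Set.Ioi 0,
        ENNReal.ofReal (r ^ a / Real.Gamma a * x ^ (a - 1) * Real.exp (-(r * x))) * f x := by
  have hm : Measurable (gammaPDF a r) := (measurable_gammaPDFReal a r).ennreal_ofReal
  rw [gammaMeasure, lintegral_withDensity_eq_lintegral_mul _ hm hf]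
  have h0 : ∫⁻ x in Set.Iio 0, (gammaPDF a r * f) x = 0 := by
    rw [setLIntegral_congr_fun (g := fun _ => 0) measurableSet_Iio, lintegral_zero]
    intro x hx
    simp [gammaPDF_of_neg (Set.mem_Iio.1 hx)]
  rw [← lintegral_add_compl _ (measurableSet_Iio (a := (0 : ℝ))), h0, zero_add, Set.compl_Iio,
    setLIntegral_congr (Ioi_ae_eq_Ici (a := (0 : ℝ))).symm]
  refine setLIntegral_congr_fun measurableSet_Ioi fun x hx => ?_
  simp [gammaPDF_of_nonneg (le_of_lt (Set.mem_Ioi.1 hx))]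

instance nullSingletonClass_gammaMeasure (a r : ℝ) : NullSingletonClass (gammaMeasure a r) := by
  unfold gammaMeasure
  infer_instance

/-- In the variables `t = x / y` and `s = x + y`, the joint density splits into a beta-prime density
in `t` times the `Gamma(a + b)` density in `s`. -/
theorem gammaMeasure_prod_map_ratio_sum {a b r : ℝ} (ha : 0 < a) (hb : 0 < b) (hr : 0 < r) :
    ((gammaMeasure a r).prod (gammaMeasure b r)).map (fun u => (u.1 / u.2, u.1 + u.2)) =
      (((gammaMeasure a r).prod (gammaMeasure b r)).map (fun u => u.1 / u.2)).prod
        (gammaMeasure (a + b) r) := by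
  have := isProbabilityMeasure_gammaMeasure ha hr
  have := isProbabilityMeasure_gammaMeasure hb hr
  have := isProbabilityMeasure_gammaMeasure (add_pos ha hb) hr
  set h : ℝ → ℝ := fun t => Real.Gamma (a + b) / (Real.Gamma a * Real.Gamma b) *
    (t ^ (a - 1) * (1 + t) ^ (-(a + b))) with hh
  have hmeas : Measurable fun t => ENNReal.ofReal (h t) := by fun_prop
  set ρ : Measure ℝ := (volume.restrict (Set.Ioi 0)).withDensity fun t => ENNReal.ofReal (h t)
  have key : ((gammaMeasure a r).prod (gammaMeasure b r)).map (fun u => (u.1 / u.2, u.1 + u.2)) =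
      ρ.prod (gammaMeasure (a + b) r) := by
    refine Measure.ext_of_lintegral _ fun f hf => ?_
    have hfm : Measurable fun u : ℝ × ℝ => f (u.1 / u.2, u.1 + u.2) := by fun_prop
    rw [lintegral_map hf (by fun_prop), lintegral_prod_symm _ hfm.aemeasurable,
      lintegral_prod _ hf.aemeasurable, lintegral_gammaMeasure _ _ hfm.lintegral_prod_left',
      lintegral_withDensity_eq_lintegral_mul _ hmeas hf.lintegral_prod_right']
    -- Substitute `x = y t` for fixed `y`. In `e2` the sum is substituted as `(1 + t) y` for fixed
    -- `t`, which produces the same integrand in `(t, y)` with the order of integration reversed.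
    have e1 : ∀ y ∈ Set.Ioi (0 : ℝ),
        ENNReal.ofReal (r ^ b / Real.Gamma b * y ^ (b - 1) * Real.exp (-(r * y))) *
          ∫⁻ x, f (x / y, x + y) ∂(gammaMeasure a r) =
        ∫⁻ t in Set.Ioi 0, ENNReal.ofReal
          ((r ^ b / Real.Gamma b * y ^ (b - 1) * Real.exp (-(r * y))) * (y *
            (r ^ a / Real.Gamma a * (y * t) ^ (a - 1) * Real.exp (-(r * (y * t)))))) *
              f (t, y * t + y) := by
      intro y hy
      have hy' : (0 : ℝ) < y := hy
      rw [lintegral_gammaMeasure _ _ (by fun_prop), ← setLIntegral_Ioi_comp_mul hy',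
        ← lintegral_const_mul _ (by fun_prop)]
      refine setLIntegral_congr_fun measurableSet_Ioi fun t ht => ?_
      have ht' : (0 : ℝ) < t := ht
      have := Real.Gamma_pos_of_pos ha
      have := Real.Gamma_pos_of_pos hb
      simp only [mul_div_cancel_left₀ t hy'.ne']
      rw [← mul_assoc, ← mul_assoc, ← ENNReal.ofReal_mul (by positivity),
        ← ENNReal.ofReal_mul (by positivity)]
      congr 2
      ring
    have e2 : ∀ t ∈ Set.Ioi (0 : ℝ),
        ((fun t => ENNReal.ofReal (h t)) * fun x => ∫⁻ y, f (x, y) ∂(gammaMeasure (a + b) r)) t =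
        ∫⁻ y in Set.Ioi 0, ENNReal.ofReal
          ((r ^ b / Real.Gamma b * y ^ (b - 1) * Real.exp (-(r * y))) * (y *
            (r ^ a / Real.Gamma a * (y * t) ^ (a - 1) * Real.exp (-(r * (y * t)))))) *
              f (t, y * t + y) := by
      intro t ht
      have ht' : (0 : ℝ) < t := ht
      have h1t : (0 : ℝ) < 1 + t := by positivity
      simp only [Pi.mul_apply]
      rw [lintegral_gammaMeasure _ _ (by fun_prop), ← setLIntegral_Ioi_comp_mul h1t,
        ← lintegral_const_mul _ (by fun_prop)]
      refine setLIntegral_congr_fun measurableSet_Ioi fun y hy => ?_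
      have hy' : (0 : ℝ) < y := hy
      have := Real.Gamma_pos_of_pos ha
      have := Real.Gamma_pos_of_pos hb
      have := Real.Gamma_pos_of_pos (add_pos ha hb)
      have hfa : (1 + t) * y = y * t + y := by ring
      simp only [hfa, ← mul_assoc]
      have hh0 : 0 ≤ h t := by simp only [hh]; positivity
      rw [← ENNReal.ofReal_mul hh0, ← ENNReal.ofReal_mul (by positivity)]
      congr 2
      simp only [hh]
      rw [← hfa, Real.mul_rpow h1t.le hy'.le, Real.mul_rpow hy'.le ht'.le, Real.rpow_neg h1t.le,
        Real.rpow_sub h1t _ 1, Real.rpow_sub hy' _ 1, Real.rpow_sub hy' _ 1,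
        Real.rpow_sub hy' _ 1, Real.rpow_sub ht' _ 1, Real.rpow_add hr, Real.rpow_add hy',
        Real.rpow_one, Real.rpow_one, Real.rpow_one,
        show -(r * ((1 + t) * y)) = -(r * y) + -(r * (y * t)) by ring, Real.exp_add]
      field_simp
    rw [setLIntegral_congr_fun measurableSet_Ioi e1, setLIntegral_congr_fun measurableSet_Ioi e2,
      lintegral_lintegral_swap (by fun_prop)]
  -- The second factor has mass one, so the first marginal of `key` identifies `ρ` without a beta
  -- integral.
  have hρ : ((gammaMeasure a r).prod (gammaMeasure b r)).map (fun u => u.1 / u.2) = ρ := by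
    have h1 := congrArg (Measure.map Prod.fst) key
    rwa [Measure.map_map (by fun_prop) (by fun_prop), Measure.map_fst_prod, measure_univ,
      one_smul] at h1
  rw [key, hρ]

end Gamma

/-! ### Chi-squared and `F` distributions. -/

section FDistribution

theorem isProbabilityMeasure_chiSquared {d : ℝ} (hd : 0 < d) :
    IsProbabilityMeasure (chiSquared d) :=
  isProbabilityMeasure_gammaMeasure (by positivity) (by positivity)

theorem isProbabilityMeasure_FDist {d₁ d₂ : ℝ} (h₁ : 0 < d₁) (h₂ : 0 < d₂) :
    IsProbabilityMeasure (FDist d₁ d₂) := by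
  have := isProbabilityMeasure_chiSquared h₁
  have := isProbabilityMeasure_chiSquared h₂
  exact Measure.isProbabilityMeasure_map (by fun_prop)

instance nullSingletonClass_chiSquared (d : ℝ) : NullSingletonClass (chiSquared d) := nullSingletonClass_gammaMeasure _ _

/-- By Fubini: for almost every denominator, at most one numerator gives the ratio `t`. -/
theorem nullSingletonClass_FDist {d₁ d₂ : ℝ} (h₁ : 0 < d₁) (h₂ : 0 < d₂) : NullSingletonClass (FDist d₁ d₂) := by
  have := isProbabilityMeasure_chiSquared h₁
  have := isProbabilityMeasure_chiSquared h₂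
  refine ⟨fun t => ?_⟩
  have hm : Measurable fun u : ℝ × ℝ => (u.1 / d₁) / (u.2 / d₂) := by fun_prop
  rw [FDist, Measure.map_apply hm (measurableSet_singleton t),
    Measure.prod_apply_symm (hm (measurableSet_singleton t)), lintegral_eq_zero_iff
      (measurable_measure_prodMk_right (hm (measurableSet_singleton t)))]
  have h0 : ∀ᵐ y ∂(chiSquared d₂), y ≠ 0 := by
    simp [ae_iff]
  filter_upwards [h0] with y hy
  have := nullSingletonClass_chiSquared d₁
  refine measure_mono_null (t := {t * (y / d₂) * d₁}) (fun x hx => ?_) (measure_singleton _)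
  simp only [Set.mem_preimage, Set.mem_singleton_iff] at hx ⊢
  rw [← hx]
  field_simp

/-- The ratio of two independent chi-squared variables is independent of their sum. -/
theorem chiSquared_prod_map_FDist {d₁ d₂ : ℝ} (h₁ : 0 < d₁) (h₂ : 0 < d₂) :
    ((chiSquared d₁).prod (chiSquared d₂)).map (fun u => ((u.1 / d₁) / (u.2 / d₂), u.1 + u.2)) =
      (FDist d₁ d₂).prod (chiSquared (d₁ + d₂)) := by
  have := isProbabilityMeasure_chiSquared h₁
  have := isProbabilityMeasure_chiSquared h₂
  have := isProbabilityMeasure_chiSquared (add_pos h₁ h₂)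
  have h := gammaMeasure_prod_map_ratio_sum (a := d₁ / 2) (b := d₂ / 2) (r := 1 / 2)
    (by positivity) (by positivity) (by positivity)
  rw [← add_div] at h
  change ((chiSquared d₁).prod (chiSquared d₂)).map _ = ((((chiSquared d₁).prod
    (chiSquared d₂)).map _).prod (chiSquared (d₁ + d₂))) at h
  have hF : FDist d₁ d₂ = (((chiSquared d₁).prod (chiSquared d₂)).map
      (fun u => u.1 / u.2)).map (fun t => d₂ / d₁ * t) := by
    rw [FDist, Measure.map_map (by fun_prop) (by fun_prop)]
    congr 1
    ext u
    simp only [Function.comp_apply]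
    rw [div_div_div_comm, mul_comm, div_div_eq_mul_div, mul_div_assoc]
  have h2 := congrArg (Measure.map (Prod.map (fun t => d₂ / d₁ * t) id)) h
  have hp : IsProbabilityMeasure (((chiSquared d₁).prod (chiSquared d₂)).map
      (fun u => u.1 / u.2)) := Measure.isProbabilityMeasure_map (by fun_prop)
  rw [← Measure.map_prod_map _ _ (by fun_prop) measurable_id, ← hF, Measure.map_id,
    Measure.map_map (by fun_prop) (by fun_prop)] at h2
  rw [← h2]
  congr 1
  ext u
  · simp only [Function.comp_apply, Prod.map]
    rw [div_div_div_comm, mul_comm, div_div_eq_mul_div, mul_div_assoc]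
  · rfl

end FDistribution

/-! ### Polar decomposition of the standard Gaussian. -/

section Polar

variable {E : Type*} [NormedAddCommGroup E] [InnerProductSpace ℝ E] [FiniteDimensional ℝ E]
  [MeasurableSpace E] [BorelSpace E]

/-- Integration in polar coordinates needs the density. Both measures are finite, so it suffices to
compare characteristic functions by means of the Gaussian Fourier integral with `b = 1 / 2`. -/
theorem stdGaussian_eq_withDensity :
    stdGaussian E = volume.withDensity fun x : E =>
      ENNReal.ofReal ((2 * Real.pi) ^ (-(Module.finrank ℝ E / 2 : ℝ)) *
        Real.exp (-(1 / 2) * ‖x‖ ^ 2)) := by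
  have hint : Integrable fun x : E => (2 * Real.pi) ^ (-(Module.finrank ℝ E / 2 : ℝ)) *
        Real.exp (-(1 / 2) * ‖x‖ ^ 2) := by
    refine Integrable.const_mul ?_ _
    have h := (GaussianFourier.integrable_cexp_neg_mul_sq_norm_add (V := E) (b := 1 / 2)
      (by norm_num) 0 0).norm
    refine h.congr (Filter.Eventually.of_forall fun x => ?_)
    simp only [Complex.norm_exp]
    congr 1
    simp [← Complex.ofReal_pow]
  have hfin : IsFiniteMeasure (volume.withDensity fun x : E =>
      ENNReal.ofReal ((2 * Real.pi) ^ (-(Module.finrank ℝ E / 2 : ℝ)) *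
        Real.exp (-(1 / 2) * ‖x‖ ^ 2))) := isFiniteMeasure_withDensity_ofReal hint.2
  refine Measure.ext_of_charFun ?_
  ext t
  rw [charFun_stdGaussian, charFun_apply, integral_withDensity_eq_integral_toReal_smul
    (by fun_prop) (by simp)]
  have hi := GaussianFourier.integral_cexp_neg_mul_sq_norm_add (V := E) (b := 1 / 2)
    (by norm_num) Complex.I t
  have hpos : (0 : ℝ) < 2 * Real.pi := by positivity
  have he : ∀ x : E, (ENNReal.ofReal ((2 * Real.pi) ^ (-(Module.finrank ℝ E / 2 : ℝ)) *
        Real.exp (-(1 / 2) * ‖x‖ ^ 2))).toReal • Complex.exp (inner ℝ x t * Complex.I) =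
      ((2 * Real.pi) ^ (-(Module.finrank ℝ E / 2 : ℝ)) : ℝ) *
        Complex.exp (-(1 / 2) * ‖x‖ ^ 2 + Complex.I * inner ℝ t x) := by
    intro x
    rw [ENNReal.toReal_ofReal (by positivity), Complex.real_smul, Complex.ofReal_mul, mul_assoc,
      Complex.exp_add, Complex.ofReal_exp, real_inner_comm, mul_comm Complex.I]
    push_cast
    rfl
  simp_rw [he]
  rw [integral_const_mul, hi, show (Real.pi / (1 / 2) : ℂ) = ((2 * Real.pi : ℝ) : ℂ) by
    push_cast; ring, Complex.I_sq, ← mul_assoc, Complex.ofReal_cpow hpos.le,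
    ← Complex.cpow_add _ _ (by exact_mod_cast hpos.ne')]
  simp
  ring_nf

/-- For a standard Gaussian vector, the squared norm is chi-squared and independent of the
direction. -/
theorem stdGaussian_map_sq_norm_direction (hE : 0 < Module.finrank ℝ E) :
    ∃ τ : Measure E, IsProbabilityMeasure τ ∧
      (stdGaussian E).map (fun x => (‖x‖ ^ 2, ‖x‖⁻¹ • x)) =
        (chiSquared (Module.finrank ℝ E)).prod τ := by
  have hE' : (0 : ℝ) < Module.finrank ℝ E := by exact_mod_cast hE
  have := isProbabilityMeasure_chiSquared hE'
  have hnt : Nontrivial E := Module.finrank_pos_iff.1 hE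
  set c : ℝ := (2 * Real.pi) ^ (-(Module.finrank ℝ E / 2 : ℝ)) with hc
  -- Chosen so that the radial density `c * exp (-r² / 2) * r ^ (dim - 1)` is `C` times the
  -- chi-squared density at `r²` times the Jacobian `2 r`.
  set C : ℝ := c * Real.Gamma (Module.finrank ℝ E / 2) /
    (2 * (1 / 2) ^ (Module.finrank ℝ E / 2 : ℝ)) with hC
  have hc0 : 0 < c := by positivity
  have hΓ : 0 < Real.Gamma (Module.finrank ℝ E / 2) := Real.Gamma_pos_of_pos (by positivity)
  have hC0 : 0 < C := by positivity
  set τ : Measure E := (ENNReal.ofReal C • (volume : Measure E).toSphere).map (↑) with hτ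
  have hfinτ : IsFiniteMeasure τ := by
    have : IsFiniteMeasure (ENNReal.ofReal C • (volume : Measure E).toSphere) :=
      Measure.smul_finite _ ENNReal.ofReal_ne_top
    infer_instance
  have hmeas : Measurable fun x : E => (‖x‖ ^ 2, ‖x‖⁻¹ • x) := by fun_prop
  have key : (stdGaussian E).map (fun x => (‖x‖ ^ 2, ‖x‖⁻¹ • x)) =
        (chiSquared (Module.finrank ℝ E)).prod τ := by
    refine Measure.ext_of_lintegral _ fun f hf => ?_
    rw [lintegral_map hf hmeas, stdGaussian_eq_withDensity,
      lintegral_withDensity_eq_lintegral_mul _ (by fun_prop) (by fun_prop),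
      lintegral_prod_symm _ hf.aemeasurable, hτ, lintegral_map hf.lintegral_prod_left'
        measurable_subtype_coe, lintegral_smul_measure]
    have h1 : ∫⁻ x : E, ((fun x : E => ENNReal.ofReal (c * Real.exp (-(1 / 2) * ‖x‖ ^ 2))) *
        fun x => f (‖x‖ ^ 2, ‖x‖⁻¹ • x)) x =
        ∫⁻ x : ({0}ᶜ : Set E), ((fun x : E => ENNReal.ofReal
          (c * Real.exp (-(1 / 2) * ‖x‖ ^ 2))) * fun x => f (‖x‖ ^ 2, ‖x‖⁻¹ • x)) x
            ∂((volume : Measure E).comap (↑)) := by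
      rw [lintegral_subtype_comap (measurableSet_singleton _).compl, restrict_compl_singleton]
    rw [h1]
    set g : Metric.sphere (0 : E) 1 × Set.Ioi (0 : ℝ) → ℝ≥0∞ := fun p =>
      ENNReal.ofReal (c * Real.exp (-(1 / 2) * (p.2 : ℝ) ^ 2)) * f ((p.2 : ℝ) ^ 2, p.1) with hg
    have hgm : Measurable g := by fun_prop
    have h2 := ((volume : Measure E).measurePreserving_homeomorphUnitSphereProd).lintegral_comp hgm
    have h3 : ∀ x : ({0}ᶜ : Set E), g (homeomorphUnitSphereProd E x) =
        ((fun x : E => ENNReal.ofReal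
          (c * Real.exp (-(1 / 2) * ‖x‖ ^ 2))) * fun x => f (‖x‖ ^ 2, ‖x‖⁻¹ • x)) x := by
      intro x
      simp [hg]
    simp_rw [← h3]
    rw [h2, lintegral_prod _ hgm.aemeasurable, smul_eq_mul, ← lintegral_const_mul _ (by fun_prop)]
    refine lintegral_congr fun s => ?_
    rw [Measure.volumeIoiPow, lintegral_withDensity_eq_lintegral_mul _ (by fun_prop) (by fun_prop),
      chiSquared, lintegral_gammaMeasure _ _ (by fun_prop), ← setLIntegral_Ioi_comp_sq,
      ← lintegral_const_mul _ (by fun_prop)]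
    have h4 := lintegral_subtype_comap (μ := (volume : Measure ℝ)) (measurableSet_Ioi (a := (0:ℝ)))
      (fun r : ℝ => ENNReal.ofReal (r ^ (Module.finrank ℝ E - 1)) *
        (ENNReal.ofReal (c * Real.exp (-(1 / 2) * r ^ 2)) * f (r ^ 2, s)))
    refine Eq.trans h4 (setLIntegral_congr_fun measurableSet_Ioi fun r hr => ?_)
    have hr' : (0 : ℝ) < r := hr
    simp only [← mul_assoc]
    rw [← ENNReal.ofReal_mul (by positivity), ← ENNReal.ofReal_mul (by positivity),
      ← ENNReal.ofReal_mul (by positivity)]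
    congr 2
    have hp : r ^ (Module.finrank ℝ E - 1) =
        r * (r ^ 2) ^ ((Module.finrank ℝ E : ℝ) / 2 - 1) := by
      have hadd : ∀ y : ℝ, r * r ^ y = r ^ (1 + y) := fun y => by
        rw [Real.rpow_add hr', Real.rpow_one]
      rw [← Real.rpow_natCast r 2, ← Real.rpow_mul hr'.le, ← Real.rpow_natCast,
        Nat.cast_sub (by omega), hadd]
      congr 1
      push_cast
      ring
    rw [hp, hC]
    field_simp
  refine ⟨τ, ⟨?_⟩, key⟩
  -- Comparing total masses in `key` shows that `τ` has mass one, without the area of the sphere.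
  have h1 := congrArg (fun m => m Set.univ) key
  have : IsProbabilityMeasure ((stdGaussian E).map (fun x => (‖x‖ ^ 2, ‖x‖⁻¹ • x))) :=
    Measure.isProbabilityMeasure_map (by fun_prop)
  simp only [measure_univ] at h1
  rw [← Set.univ_prod_univ, Measure.prod_prod, measure_univ, one_mul] at h1
  exact h1.symm

end Polar

/-! ### Independence of orthogonal projections of a Gaussian vector. -/

section Projections

variable {E : Type*} [NormedAddCommGroup E] [InnerProductSpace ℝ E] [FiniteDimensional ℝ E]
  [MeasurableSpace E] [BorelSpace E]

theorem stdGaussian_prod {F : Type*} [NormedAddCommGroup F] [InnerProductSpace ℝ F]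
    [FiniteDimensional ℝ F] [MeasurableSpace F] [BorelSpace F] :
    stdGaussian (WithLp 2 (E × F)) =
      ((stdGaussian E).prod (stdGaussian F)).map (WithLp.toLp 2) := by
  have : IsProbabilityMeasure (((stdGaussian E).prod (stdGaussian F)).map (WithLp.toLp 2)) :=
    Measure.isProbabilityMeasure_map (by fun_prop)
  refine Measure.ext_of_charFun ?_
  ext t
  rw [charFun_stdGaussian, charFun_prod, charFun_stdGaussian, charFun_stdGaussian,
    ← Complex.exp_add, ← Complex.ofReal_pow, WithLp.prod_norm_sq_eq_of_L2]
  congr 1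
  push_cast
  simp only [WithLp.fst, WithLp.snd]
  ring

/-- The decomposition `E ≃ U × Uᗮ` is a linear isometry, and such maps preserve the standard
Gaussian. -/
theorem stdGaussian_map_projections (U : Submodule ℝ E) :
    (stdGaussian E).map (fun x => (U.orthogonalProjectionOnto x, Uᗮ.orthogonalProjectionOnto x)) =
      (stdGaussian U).prod (stdGaussian Uᗮ) := by
  have h := stdGaussian_map U.orthogonalDecomposition
  rw [stdGaussian_prod] at h
  have h2 := congrArg (Measure.map WithLp.ofLp) h
  rw [Measure.map_map (by fun_prop) (by fun_prop), Measure.map_map (by fun_prop) (by fun_prop)] at h2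
  have h3 : (WithLp.ofLp ∘ WithLp.toLp 2 : U × Uᗮ → U × Uᗮ) = id := rfl
  rw [h3, Measure.map_id] at h2
  rw [← h2]
  congr 1
  ext x <;> simp [Submodule.orthogonalDecomposition_apply]

theorem map_starProjection_stdGaussian (U : Submodule ℝ E) :
    (stdGaussian E).map U.starProjection = (stdGaussian U).map (↑) := by
  have h := congrArg (Measure.map (fun p : U × Uᗮ => (p.1 : E))) (stdGaussian_map_projections U)
  rw [Measure.map_map (by fun_prop) (by fun_prop)] at h
  have h2 : ((stdGaussian U).prod (stdGaussian Uᗮ)).map (fun p : U × Uᗮ => (p.1 : E)) =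
      (((stdGaussian U).prod (stdGaussian Uᗮ)).map Prod.fst).map (↑) := by
    rw [Measure.map_map (by fun_prop) (by fun_prop)]
    rfl
  rw [h2, Measure.map_fst_prod, measure_univ, one_smul] at h
  rw [← h]
  rfl

theorem indepFun_starProjection_stdGaussian (U : Submodule ℝ E) :
    IndepFun U.starProjection Uᗮ.starProjection (stdGaussian E) := by
  have h : IndepFun (fun x => U.orthogonalProjectionOnto x)
      (fun x => Uᗮ.orthogonalProjectionOnto x) (stdGaussian E) := by
    rw [indepFun_iff_map_prod_eq_prod_map_map (by fun_prop) (by fun_prop)]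
    have h0 := stdGaussian_map_projections U
    have h1 := congrArg (Measure.map Prod.fst) h0
    have h2 := congrArg (Measure.map Prod.snd) h0
    rw [Measure.map_map (by fun_prop) (by fun_prop), Measure.map_fst_prod, measure_univ,
      one_smul] at h1
    rw [Measure.map_map (by fun_prop) (by fun_prop), Measure.map_snd_prod, measure_univ,
      one_smul] at h2
    change Measure.map (fun x => U.orthogonalProjectionOnto x) _ = _ at h1
    change Measure.map (fun x => Uᗮ.orthogonalProjectionOnto x) _ = _ at h2
    rw [h0, h1, h2]
  exact h.comp (φ := ((↑) : U → E)) (ψ := ((↑) : Uᗮ → E)) (by fun_prop) (by fun_prop)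

/-- The squared norm and the direction of the projection of a standard Gaussian vector. -/
theorem map_sq_norm_direction_starProjection (U : Submodule ℝ E) (hU : 0 < Module.finrank ℝ U) :
    ∃ τ : Measure E, IsProbabilityMeasure τ ∧
      (stdGaussian E).map
        (fun x => (‖U.starProjection x‖ ^ 2, ‖U.starProjection x‖⁻¹ • U.starProjection x)) =
        (chiSquared (Module.finrank ℝ U)).prod τ := by
  obtain ⟨τ, hτ, h⟩ := stdGaussian_map_sq_norm_direction hU
  refine ⟨τ.map (↑), Measure.isProbabilityMeasure_map (by fun_prop), ?_⟩
  have := isProbabilityMeasure_chiSquared (d := Module.finrank ℝ U) (by exact_mod_cast hU)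
  have h1 : (stdGaussian E).map
        (fun x => (‖U.starProjection x‖ ^ 2, ‖U.starProjection x‖⁻¹ • U.starProjection x)) =
      ((stdGaussian E).map U.starProjection).map (fun y => (‖y‖ ^ 2, ‖y‖⁻¹ • y)) := by
    rw [Measure.map_map (by fun_prop) (by fun_prop)]
    rfl
  have h2 := congrArg (Measure.map (Prod.map id ((↑) : U → E))) h
  rw [Measure.map_map (by fun_prop) (by fun_prop),
    ← Measure.map_prod_map _ _ measurable_id (by fun_prop), Measure.map_id] at h2
  rw [h1, map_starProjection_stdGaussian, Measure.map_map (by fun_prop) (by fun_prop), ← h2]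
  rfl

variable {U W : Submodule ℝ E}

/-- Orthogonality makes the `W`-component and the remainder functions of the projection to `Uᗮ`;
likewise the remainder is a function of the projection to `Wᗮ`. Together the two claims give mutual
independence of the three components. -/
theorem indepFun_starProjection_of_isOrtho (h : U ⟂ W) :
    IndepFun U.starProjection
      (fun x => (W.starProjection x, x - U.starProjection x - W.starProjection x))
      (stdGaussian E) ∧
    IndepFun W.starProjection (fun x => x - U.starProjection x - W.starProjection x)
      (stdGaussian E) := by
  have e : ∀ x, Uᗮ.starProjection x = x - U.starProjection x := fun x => by
    rw [Submodule.starProjection_orthogonal']; simp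
  have e' : ∀ x, Wᗮ.starProjection x = x - W.starProjection x := fun x => by
    rw [Submodule.starProjection_orthogonal']; simp
  have hWU : ∀ x, W.starProjection (U.starProjection x) = 0 := fun x => by
    rw [Submodule.starProjection_apply_eq_zero_iff]
    exact h (Submodule.starProjection_apply_mem U x)
  have hUW : ∀ x, U.starProjection (W.starProjection x) = 0 := fun x => by
    rw [Submodule.starProjection_apply_eq_zero_iff]
    exact h.symm (Submodule.starProjection_apply_mem W x)
  constructor
  · have := (indepFun_starProjection_stdGaussian U).comp (φ := id)
      (ψ := fun y => (W.starProjection y, y - W.starProjection y)) measurable_id (by fun_prop)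
    convert! this using 1
    ext x <;> simp [e, hWU]
  · have := (indepFun_starProjection_stdGaussian W).comp (φ := id)
      (ψ := fun y => y - U.starProjection y) measurable_id (by fun_prop)
    convert! this using 1
    ext x
    simp [e', hUW]
    abel

end Projections

/-! ### The `F` ratio of two orthogonal projections. -/

section Ratio

theorem prod_prod_map_prodProdProdComm {α β γ δ : Type*} [MeasurableSpace α] [MeasurableSpace β]
    [MeasurableSpace γ] [MeasurableSpace δ] (μ₁ : Measure α) (μ₂ : Measure β) (μ₃ : Measure γ)
    (μ₄ : Measure δ) [SFinite μ₁] [SFinite μ₂] [SFinite μ₃] [SFinite μ₄] :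
    ((μ₁.prod μ₂).prod (μ₃.prod μ₄)).map (fun p => ((p.1.1, p.2.1), (p.1.2, p.2.2))) =
      (μ₁.prod μ₃).prod (μ₂.prod μ₄) := by
  refine Measure.ext_of_lintegral _ fun f hf => ?_
  rw [lintegral_map hf (by fun_prop), lintegral_prod _ (by fun_prop), lintegral_prod _ (by fun_prop),
    lintegral_prod _ hf.aemeasurable, lintegral_prod _ (by fun_prop)]
  refine lintegral_congr fun a => ?_
  have h1 : ∀ b, ∫⁻ y, f ((a, y.1), (b, y.2)) ∂(μ₃.prod μ₄) =
      ∫⁻ c, ∫⁻ d, f ((a, c), (b, d)) ∂μ₄ ∂μ₃ := fun b => lintegral_prod _ (by fun_prop)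
  have h2 : ∀ c, ∫⁻ y, f ((a, c), y) ∂(μ₂.prod μ₄) =
      ∫⁻ b, ∫⁻ d, f ((a, c), (b, d)) ∂μ₄ ∂μ₂ := fun c => lintegral_prod _ (by fun_prop)
  simp_rw [h1, h2]
  exact lintegral_lintegral_swap (by fun_prop)

variable {E : Type*} [NormedAddCommGroup E] [InnerProductSpace ℝ E] [FiniteDimensional ℝ E]
  [MeasurableSpace E] [BorelSpace E] {U W : Submodule ℝ E}

/-- For a standard Gaussian vector and orthogonal subspaces, the `F` ratio of the squared norms of
the projections is independent of the directions of the projections, the sum of the squared norms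
and the remaining component. -/
theorem stdGaussian_map_FRatio (h : U ⟂ W) (hU : 0 < Module.finrank ℝ U)
    (hW : 0 < Module.finrank ℝ W) :
    ∃ κ : Measure (E × E × ℝ × E), IsProbabilityMeasure κ ∧
    (stdGaussian E).map (fun x =>
      ((‖U.starProjection x‖⁻¹ • U.starProjection x, ‖W.starProjection x‖⁻¹ • W.starProjection x,
        ‖U.starProjection x‖ ^ 2 + ‖W.starProjection x‖ ^ 2,
        x - U.starProjection x - W.starProjection x),
        (‖U.starProjection x‖ ^ 2 / Module.finrank ℝ U) /
          (‖W.starProjection x‖ ^ 2 / Module.finrank ℝ W))) =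
      κ.prod (FDist (Module.finrank ℝ U) (Module.finrank ℝ W)) := by
  have hU' : (0 : ℝ) < Module.finrank ℝ U := by exact_mod_cast hU
  have hW' : (0 : ℝ) < Module.finrank ℝ W := by exact_mod_cast hW
  have := isProbabilityMeasure_chiSquared hU'
  have := isProbabilityMeasure_chiSquared hW'
  have := isProbabilityMeasure_chiSquared (add_pos hU' hW')
  have := isProbabilityMeasure_FDist hU' hW'
  obtain ⟨τ₁, hτ₁, h₁⟩ := map_sq_norm_direction_starProjection U hU
  obtain ⟨τ₂, hτ₂, h₂⟩ := map_sq_norm_direction_starProjection W hW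
  obtain ⟨i₁, i₂⟩ := indepFun_starProjection_of_isOrtho h
  set γ := stdGaussian E
  set ρ := γ.map (fun x => x - U.starProjection x - W.starProjection x) with hρ
  have hρp : IsProbabilityMeasure ρ := Measure.isProbabilityMeasure_map (by fun_prop)
  set dU : ℝ := (Module.finrank ℝ U : ℝ)
  set dW : ℝ := (Module.finrank ℝ W : ℝ)
  have j₂ : γ.map (fun x =>
      ((‖W.starProjection x‖ ^ 2, ‖W.starProjection x‖⁻¹ • W.starProjection x),
        x - U.starProjection x - W.starProjection x)) =
      ((chiSquared dW).prod τ₂).prod ρ := by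
    rw [← h₂, hρ]
    exact (indepFun_iff_map_prod_eq_prod_map_map (by fun_prop) (by fun_prop)).1
      (i₂.comp (φ := fun y => (‖y‖ ^ 2, ‖y‖⁻¹ • y)) (ψ := id) (by fun_prop) measurable_id)
  have j₁ : γ.map (fun x =>
      ((‖U.starProjection x‖ ^ 2, ‖U.starProjection x‖⁻¹ • U.starProjection x),
      ((‖W.starProjection x‖ ^ 2, ‖W.starProjection x‖⁻¹ • W.starProjection x),
        x - U.starProjection x - W.starProjection x))) =
      ((chiSquared dU).prod τ₁).prod (((chiSquared dW).prod τ₂).prod ρ) := by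
    rw [← h₁, ← j₂]
    exact (indepFun_iff_map_prod_eq_prod_map_map (by fun_prop) (by fun_prop)).1
      (i₁.comp (φ := fun y => (‖y‖ ^ 2, ‖y‖⁻¹ • y))
        (ψ := fun p => ((‖p.1‖ ^ 2, ‖p.1‖⁻¹ • p.1), p.2)) (by fun_prop) (by fun_prop))
  -- Regrouping the independent factors puts the two squared norms side by side, so that
  -- `chiSquared_prod_map_FDist` can trade them for their ratio and sum.
  have j₃ : γ.map (fun x =>
      ((‖U.starProjection x‖ ^ 2, ‖W.starProjection x‖ ^ 2),
        (‖U.starProjection x‖⁻¹ • U.starProjection x,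
          (‖W.starProjection x‖⁻¹ • W.starProjection x,
        x - U.starProjection x - W.starProjection x)))) =
      ((chiSquared dU).prod (chiSquared dW)).prod (τ₁.prod (τ₂.prod ρ)) := by
    rw [← prod_prod_map_prodProdProdComm, ← (measurePreserving_prodAssoc _ τ₂ ρ).map_eq]
    nth_rewrite 1 [← Measure.map_id (μ := (chiSquared dU).prod τ₁)]
    rw [Measure.map_prod_map _ _ measurable_id (by fun_prop), ← j₁,
      Measure.map_map (by fun_prop) (by fun_prop), Measure.map_map (by fun_prop) (by fun_prop)]
    rfl
  have j₄ : γ.map (fun x =>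
      (((‖U.starProjection x‖ ^ 2 / dU) / (‖W.starProjection x‖ ^ 2 / dW),
        ‖U.starProjection x‖ ^ 2 + ‖W.starProjection x‖ ^ 2),
        (‖U.starProjection x‖⁻¹ • U.starProjection x,
          (‖W.starProjection x‖⁻¹ • W.starProjection x,
        x - U.starProjection x - W.starProjection x)))) =
      ((FDist dU dW).prod (chiSquared (dU + dW))).prod (τ₁.prod (τ₂.prod ρ)) := by
    rw [← chiSquared_prod_map_FDist hU' hW', ← Measure.map_id (μ := τ₁.prod (τ₂.prod ρ)),
      Measure.map_prod_map _ _ (by fun_prop) measurable_id, ← j₃,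
      Measure.map_map (by fun_prop) (by fun_prop)]
    rfl
  refine ⟨((chiSquared (dU + dW)).prod (τ₁.prod (τ₂.prod ρ))).map
    (fun p => (p.2.1, p.2.2.1, p.1, p.2.2.2)), Measure.isProbabilityMeasure_map (by fun_prop), ?_⟩
  rw [← Measure.prod_swap]
  nth_rewrite 1 [← Measure.map_id (μ := FDist dU dW)]
  rw [Measure.map_prod_map _ _ measurable_id (by fun_prop),
    ← (measurePreserving_prodAssoc _ _ _).map_eq, ← j₄,
    Measure.map_map (by fun_prop) (by fun_prop), Measure.map_map (by fun_prop) (by fun_prop),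
    Measure.map_map (by fun_prop) (by fun_prop)]
  rfl

theorem ae_starProjection_stdGaussian_ne_zero (hU : 0 < Module.finrank ℝ U) :
    ∀ᵐ x ∂(stdGaussian E), U.starProjection x ≠ 0 := by
  have hU' : (0 : ℝ) < Module.finrank ℝ U := by exact_mod_cast hU
  have := isProbabilityMeasure_chiSquared hU'
  obtain ⟨τ, hτ, h⟩ := map_sq_norm_direction_starProjection U hU
  have h1 := congrArg (Measure.map Prod.fst) h
  rw [Measure.map_map (by fun_prop) (by fun_prop), Measure.map_fst_prod, measure_univ,
    one_smul] at h1
  have h2 : ∀ᵐ y ∂(chiSquared (Module.finrank ℝ U)), y ≠ 0 := by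
    simp [ae_iff, (nullSingletonClass_chiSquared _).measure_singleton]
  rw [← h1] at h2
  filter_upwards [ae_of_ae_map (by fun_prop) h2] with x hx h0
  simp [h0] at hx

end Ratio

/-! ### Left multiplication of matrices as a projection of Euclidean vectors. -/

section Kronecker

open scoped Kronecker

variable {m q : ℕ}

/-- The entries of a matrix as a Euclidean vector. -/
def Matrix.toEuclideanVec : Matrix (Fin m) (Fin q) ℝ →ₗ[ℝ] EuclideanSpace ℝ (Fin m × Fin q) where
  toFun A := WithLp.toLp 2 fun p => A p.1 p.2
  map_add' _ _ := rfl
  map_smul' _ _ := rfl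

@[simp]
theorem Matrix.toEuclideanVec_apply (A : Matrix (Fin m) (Fin q) ℝ) (p : Fin m × Fin q) :
    A.toEuclideanVec p = A p.1 p.2 := rfl

theorem Matrix.norm_toEuclideanVec (A : Matrix (Fin m) (Fin q) ℝ) : ‖A.toEuclideanVec‖ = ‖A‖ := by
  rw [Matrix.frobenius_norm_def, EuclideanSpace.norm_eq, Real.sqrt_eq_rpow, Fintype.sum_prod_type]
  simp

/-- The matrix with given Euclidean vector of entries. -/
def Matrix.ofEuclideanVec : EuclideanSpace ℝ (Fin m × Fin q) →ₗ[ℝ] Matrix (Fin m) (Fin q) ℝ where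
  toFun x := Matrix.of fun i j => x (i, j)
  map_add' _ _ := rfl
  map_smul' _ _ := rfl

theorem Matrix.ofEuclideanVec_toEuclideanVec (A : Matrix (Fin m) (Fin q) ℝ) :
    Matrix.ofEuclideanVec A.toEuclideanVec = A := rfl

theorem Matrix.measurable_toEuclideanVec :
    Measurable (Matrix.toEuclideanVec (m := m) (q := q)) := by
  refine (WithLp.measurable_toLp 2 _).comp (measurable_pi_lambda _ fun p => ?_)
  exact (measurable_pi_apply p.2).comp (measurable_pi_apply p.1)

theorem Matrix.measurable_ofEuclideanVec :
    Measurable (Matrix.ofEuclideanVec (m := m) (q := q)) := by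
  refine measurable_pi_lambda _ fun i => measurable_pi_lambda _ fun j => ?_
  change Measurable fun x : EuclideanSpace ℝ (Fin m × Fin q) => x (i, j)
  fun_prop

/-- The subspace of matrices (as Euclidean vectors) onto which a left multiplication projects. -/
noncomputable def Matrix.leftRange (q : ℕ) (Q : Matrix (Fin m) (Fin m) ℝ) :
    Submodule ℝ (EuclideanSpace ℝ (Fin m × Fin q)) :=
  (Matrix.toEuclideanCLM (n := Fin m × Fin q) (𝕜 := ℝ)
    (Q ⊗ₖ (1 : Matrix (Fin q) (Fin q) ℝ))).range

theorem Matrix.toEuclideanCLM_kronecker_one (Q : Matrix (Fin m) (Fin m) ℝ)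
    (A : Matrix (Fin m) (Fin q) ℝ) :
    Matrix.toEuclideanCLM (n := Fin m × Fin q) (𝕜 := ℝ)
      (Q ⊗ₖ (1 : Matrix (Fin q) (Fin q) ℝ)) A.toEuclideanVec = (Q * A).toEuclideanVec := by
  ext p
  simp [Matrix.mulVec, dotProduct, Fintype.sum_prod_type, Matrix.mul_apply,
    Matrix.one_apply]

variable {Q : Matrix (Fin m) (Fin m) ℝ}

theorem IsStarProjection.kronecker_one (hQ : IsStarProjection Q) :
    IsStarProjection (Q ⊗ₖ (1 : Matrix (Fin q) (Fin q) ℝ)) := by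
  refine ⟨?_, ?_⟩
  · rw [IsIdempotentElem, ← Matrix.mul_kronecker_mul, hQ.isIdempotentElem.eq, one_mul]
  · rw [IsSelfAdjoint, Matrix.star_eq_conjTranspose, Matrix.conjTranspose_kronecker,
      ← Matrix.star_eq_conjTranspose, hQ.isSelfAdjoint.star_eq, Matrix.conjTranspose_one]

/-- On vectorised matrices, `A ↦ Q * A` acts as `Q ⊗ₖ 1`, which is again a star projection and thus
the orthogonal projection onto its range. -/
theorem IsStarProjection.starProjection_leftRange (hQ : IsStarProjection Q)
    (A : Matrix (Fin m) (Fin q) ℝ) :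
    (Q.leftRange q).starProjection A.toEuclideanVec = (Q * A).toEuclideanVec := by
  have h : IsStarProjection (Matrix.toEuclideanCLM (n := Fin m × Fin q) (𝕜 := ℝ)
      (Q ⊗ₖ (1 : Matrix (Fin q) (Fin q) ℝ))) := hQ.kronecker_one.map _
  obtain ⟨_, h⟩ := isStarProjection_iff_eq_starProjection_range.1 h
  rw [← Matrix.toEuclideanCLM_kronecker_one]
  conv_rhs => rw [h]
  rfl

theorem IsIdempotentElem.finrank_range_toEuclideanCLM {ι : Type*} [Fintype ι] [DecidableEq ι]
    {Q : Matrix ι ι ℝ} (hQ : IsIdempotentElem Q) :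
    (Module.finrank ℝ (Matrix.toEuclideanCLM (n := ι) (𝕜 := ℝ) Q).range : ℝ) = Q.trace := by
  have h := (LinearMap.IsIdempotentElem.isProj_range
    (Matrix.toEuclideanCLM (n := ι) (𝕜 := ℝ) Q : EuclideanSpace ℝ ι →ₗ[ℝ] EuclideanSpace ℝ ι)
    (by
      have := hQ.map (Matrix.toEuclideanCLM (n := ι) (𝕜 := ℝ))
      rw [IsIdempotentElem] at this ⊢
      ext1 x
      exact congrArg (fun f : EuclideanSpace ℝ ι →L[ℝ] EuclideanSpace ℝ ι => f x) this)).trace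
  have hlin : Matrix.toEuclideanLin Q =
      Matrix.toLin (PiLp.basisFun 2 ℝ ι) (PiLp.basisFun 2 ℝ ι) Q := by
    rw [← Matrix.toLpLin_eq_toLin]
  rw [← h, Matrix.coe_toEuclideanCLM_eq_toEuclideanLin, hlin,
    LinearMap.trace_eq_matrix_trace ℝ (PiLp.basisFun 2 ℝ ι), LinearMap.toMatrix_toLin]

/-- The rank of an idempotent is its trace, and tensoring with the identity of size `q` multiplies
the trace by `q`. This is the factor `q` in `d` and `d*`. -/
theorem IsIdempotentElem.finrank_leftRange (hQ : IsIdempotentElem Q) :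
    (Module.finrank ℝ (Q.leftRange q) : ℝ) = q * Q.trace := by
  have h : IsIdempotentElem (Q ⊗ₖ (1 : Matrix (Fin q) (Fin q) ℝ)) := by
    rw [IsIdempotentElem, ← Matrix.mul_kronecker_mul, hQ.eq, one_mul]
  rw [Matrix.leftRange, h.finrank_range_toEuclideanCLM, Matrix.trace_kronecker, Matrix.trace_one,
    Fintype.card_fin, mul_comm]

theorem Matrix.isOrtho_leftRange {R : Matrix (Fin m) (Fin m) ℝ} (hQ : IsStarProjection Q)
    (hQR : Q * R = 0) : Q.leftRange q ⟂ R.leftRange q := by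
  rw [Submodule.isOrtho_iff_inner_eq]
  rintro _ ⟨x, rfl⟩ _ ⟨y, rfl⟩
  have hsa := (hQ.kronecker_one (q := q)).isSelfAdjoint.map
    (Matrix.toEuclideanCLM (n := Fin m × Fin q) (𝕜 := ℝ))
  have hadj := ContinuousLinearMap.adjoint_inner_right (Matrix.toEuclideanCLM
    (n := Fin m × Fin q) (𝕜 := ℝ) (Q ⊗ₖ (1 : Matrix (Fin q) (Fin q) ℝ))) x
    (Matrix.toEuclideanCLM (n := Fin m × Fin q) (𝕜 := ℝ)
      (R ⊗ₖ (1 : Matrix (Fin q) (Fin q) ℝ)) y)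
  rw [hsa.adjoint_eq, ← mul_apply_eq_comp, ← map_mul, ← Matrix.mul_kronecker_mul,
    hQR, one_mul, Matrix.zero_kronecker, map_zero, _root_.zero_apply,
    inner_zero_right] at hadj
  exact hadj.symm

end Kronecker

/-! ### Algebra of `PE` and `P1`, and the effect of the null hypothesis. -/

namespace ClusterInference
section Projections

variable {n q K : ℕ} (V : Finset (Fin K × Fin K)) (c : Fin n → Fin K)

theorem indVec_dotProduct (k l : Fin K) :
    indVec c k ⬝ᵥ indVec c l = if k = l then ((cluster c k).card : ℝ) else 0 := by
  rw [dotProduct]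
  by_cases h : k = l
  · subst h
    rw [if_pos rfl, cluster, Finset.card_filter, Nat.cast_sum]
    refine Finset.sum_congr rfl fun i _ => ?_
    by_cases hi : c i = k <;> simp [indVec, hi]
  · rw [if_neg h]
    refine Finset.sum_eq_zero fun i _ => ?_
    simp only [indVec]
    by_cases h1 : c i = k
    · rw [if_neg (fun h2 => h (h1.symm.trans h2)), mul_zero]
    · rw [if_neg h1, zero_mul]

theorem indVec_mul_indVec (k l : Fin K) :
    indVec c k * indVec c l = if k = l then indVec c k else 0 := by
  ext i
  by_cases h : k = l
  · subst h
    simp [indVec]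
  · rw [if_neg h]
    simp only [indVec, Pi.mul_apply, Pi.zero_apply]
    by_cases h1 : c i = k
    · rw [if_neg (fun h2 => h (h1.symm.trans h2)), mul_zero]
    · rw [if_neg h1, zero_mul]

/-- The centering matrix `I_{𝒞_k} - 𝟏_{𝒞_k} 𝟏_{𝒞_k}ᵀ / |𝒞_k|` of a cluster. -/
noncomputable def clusterCentering (k : Fin K) : Matrix (Fin n) (Fin n) ℝ :=
  Matrix.diagonal (indVec c k)
    - ((cluster c k).card : ℝ)⁻¹ • Matrix.vecMulVec (indVec c k) (indVec c k)

theorem P1_eq_sum : P1 V c = ∑ k ∈ interest V, clusterCentering c k := rfl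

theorem clusterCentering_mulVec (k : Fin K) (v : Fin n → ℝ) :
    clusterCentering c k *ᵥ v =
      indVec c k * v - (((cluster c k).card : ℝ)⁻¹ * (indVec c k ⬝ᵥ v)) • indVec c k := by
  rw [clusterCentering, Matrix.sub_mulVec, Matrix.smul_mulVec, Matrix.vecMulVec_mulVec]
  ext i
  simp [Matrix.mulVec_diagonal]
  ring

theorem clusterCentering_mulVec_of_const {k : Fin K} {v : Fin n → ℝ} {a : ℝ}
    (h : ∀ i ∈ cluster c k, v i = a) : clusterCentering c k *ᵥ v = 0 := by
  have h1 : indVec c k * v = a • indVec c k := by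
    ext i
    by_cases hi : c i = k
    · simp [indVec, hi, h i (by simp [cluster, hi])]
    · simp [indVec, hi]
  have h2 : indVec c k ⬝ᵥ v = a * (cluster c k).card := by
    have h3 : indVec c k ⬝ᵥ v = ∑ i, (indVec c k * v) i := rfl
    rw [h3, h1]
    simp [indVec, cluster, Finset.sum_ite, mul_comm]
  rw [clusterCentering_mulVec, h1, h2, ← sub_smul]
  -- For an empty cluster the inverse cardinality is the default value `0`, but the indicator
  -- vanishes too.
  by_cases h0 : ((cluster c k).card : ℝ) = 0
  · have : indVec c k = 0 := by
      ext i
      have hi : i ∉ cluster c k := by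
        rw [Finset.card_eq_zero.1 (by exact_mod_cast h0 : (cluster c k).card = 0)]
        exact Finset.notMem_empty i
      have hi' : c i ≠ k := fun h => hi (by simp [cluster, h])
      simp [indVec, hi']
    rw [this, smul_zero]
  · rw [show a - ((cluster c k).card : ℝ)⁻¹ * (a * (cluster c k).card) = 0 by field_simp; ring,
      zero_smul]

/-- For `k = l`, the part subtracted by centering is a multiple of the indicator, which a second
centering kills. For `k ≠ l`, a vector centred on cluster `l` is supported there, hence zero on
cluster `k`. -/
theorem clusterCentering_mul (k l : Fin K) :
    clusterCentering c k * clusterCentering c l =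
      if k = l then clusterCentering c k else 0 := by
  refine Matrix.ext_of_mulVec_single fun j => ?_
  rw [← Matrix.mulVec_mulVec]
  generalize (Pi.single j 1 : Fin n → ℝ) = v
  by_cases h : k = l
  · subst h
    rw [if_pos rfl, clusterCentering_mulVec c k v, Matrix.mulVec_sub, Matrix.mulVec_smul,
      clusterCentering_mulVec_of_const c (k := k) (v := indVec c k) (a := 1)
        (fun i hi => by simpa [indVec, cluster] using hi), smul_zero, sub_zero,
      clusterCentering_mulVec, ← mul_assoc, indVec_mul_indVec, if_pos rfl]
    congr 3
    simp only [dotProduct, Pi.mul_apply]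
    refine Finset.sum_congr rfl fun i _ => ?_
    by_cases hi : c i = k <;> simp [indVec, hi]
  · rw [if_neg h, Matrix.zero_mulVec]
    refine clusterCentering_mulVec_of_const c (a := 0) fun i hi => ?_
    have hi' : c i = k := by simpa [cluster] using hi
    have hl : indVec c l i = 0 := by simp [indVec, hi', h]
    simp [clusterCentering_mulVec, hl]

/-- Nonemptiness matters: the centering matrix of an empty cluster is zero, with trace `0` and not
`-1`. -/
theorem trace_clusterCentering {k : Fin K} (h : (cluster c k).Nonempty) :
    (clusterCentering c k).trace = (cluster c k).card - 1 := by
  have h0 : ((cluster c k).card : ℝ) ≠ 0 := by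
    exact_mod_cast h.card_ne_zero
  have hd : (Matrix.diagonal (indVec c k)).trace = ((cluster c k).card : ℝ) := by
    rw [Matrix.trace_diagonal]
    simp [indVec, cluster]
  rw [clusterCentering, Matrix.trace_sub, Matrix.trace_smul, Matrix.trace_vecMulVec,
    indVec_dotProduct, if_pos rfl, hd, smul_eq_mul, inv_mul_cancel₀ h0]

theorem isStarProjection_P1 : IsStarProjection (P1 V c) := by
  refine ⟨?_, ?_⟩
  · rw [IsIdempotentElem, P1_eq_sum, Finset.sum_mul_sum]
    refine Finset.sum_congr rfl fun k hk => ?_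
    simp_rw [clusterCentering_mul]
    rw [Finset.sum_ite_eq, if_pos hk]
  · rw [IsSelfAdjoint, P1_eq_sum, star_sum]
    refine Finset.sum_congr rfl fun k _ => ?_
    rw [Matrix.star_eq_conjTranspose, clusterCentering, Matrix.conjTranspose_sub,
      Matrix.conjTranspose_smul, Matrix.diagonal_conjTranspose, Matrix.conjTranspose_vecMulVec]
    simp

theorem toEuclideanCLM_PE :
    Matrix.toEuclideanCLM (n := Fin n) (𝕜 := ℝ) (PE V c) = (contrastSpace V c).starProjection :=
  StarAlgEquiv.apply_symm_apply _ _

theorem isStarProjection_PE : IsStarProjection (PE V c) := by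
  have h := isStarProjection_starProjection (U := contrastSpace V c)
  refine ⟨?_, ?_⟩
  · rw [IsIdempotentElem, PE, ← map_mul, h.isIdempotentElem.eq]
  · refine EquivLike.injective (Matrix.toEuclideanCLM (n := Fin n) (𝕜 := ℝ)) ?_
    rw [map_star, toEuclideanCLM_PE, h.isSelfAdjoint.star_eq]

theorem toLp_PE_mulVec (v : Fin n → ℝ) :
    WithLp.toLp 2 (PE V c *ᵥ v) = (contrastSpace V c).starProjection (WithLp.toLp 2 v) := by
  rw [← toEuclideanCLM_PE, Matrix.toEuclideanCLM_toLp]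

theorem P1_mulVec_indVec (l : Fin K) : P1 V c *ᵥ indVec c l = 0 := by
  rw [P1_eq_sum, Matrix.sum_mulVec]
  refine Finset.sum_eq_zero fun k _ => ?_
  refine clusterCentering_mulVec_of_const c (a := if k = l then 1 else 0) fun i hi => ?_
  have hi' : c i = k := by simpa [cluster] using hi
  simp [indVec, hi']

theorem P1_mulVec_of_mem_contrastSpace {x : EuclideanSpace ℝ (Fin n)}
    (hx : x ∈ contrastSpace V c) : P1 V c *ᵥ x.ofLp = 0 := by
  induction hx using Submodule.span_induction with
  | mem x hx =>
    obtain ⟨p, _, rfl⟩ := hx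
    simp [contrast, Matrix.mulVec_sub, Matrix.mulVec_smul, P1_mulVec_indVec]
  | zero => simp
  | add x y _ _ hx hy => rw [WithLp.ofLp_add, Matrix.mulVec_add, hx, hy, add_zero]
  | smul a x _ hx => rw [WithLp.ofLp_smul, Matrix.mulVec_smul, hx, smul_zero]

/-- Contrasts are constant on each cluster, and centering annihilates such vectors. -/
theorem P1_mul_PE : P1 V c * PE V c = 0 := by
  refine Matrix.ext_of_mulVec_single fun j => ?_
  rw [← Matrix.mulVec_mulVec, Matrix.zero_mulVec]
  have h := P1_mulVec_of_mem_contrastSpace V c (x := WithLp.toLp 2 (PE V c *ᵥ Pi.single j 1))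
    (by rw [toLp_PE_mulVec]; exact Submodule.starProjection_apply_mem _ _)
  exact h

theorem PE_mul_P1 : PE V c * P1 V c = 0 := by
  have h := congrArg star (P1_mul_PE V c)
  rwa [star_mul, (isStarProjection_P1 V c).isSelfAdjoint.star_eq,
    (isStarProjection_PE V c).isSelfAdjoint.star_eq, star_zero] at h

theorem df_eq_finrank :
    df q V c = Module.finrank ℝ ((PE V c).leftRange q) := by
  rw [(isStarProjection_PE V c).isIdempotentElem.finrank_leftRange,
    ← (isStarProjection_PE V c).isIdempotentElem.finrank_range_toEuclideanCLM, df,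
    toEuclideanCLM_PE, Submodule.range_starProjection]

variable {V c}

theorem dfStar_eq_finrank (h : ∀ k ∈ interest V, (cluster c k).Nonempty) :
    dfStar q V c = Module.finrank ℝ ((P1 V c).leftRange q) := by
  rw [(isStarProjection_P1 V c).isIdempotentElem.finrank_leftRange, P1_eq_sum, Matrix.trace_sum,
    Finset.sum_congr rfl fun k hk => trace_clusterCentering c (h k hk), Finset.sum_sub_distrib,
    dfStar]
  simp

theorem mem_interest_left {p : Fin K × Fin K} (hp : p ∈ V) : p.1 ∈ interest V := by
  simp only [interest, Finset.mem_filter, Finset.mem_univ, true_and]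
  exact ⟨p.2, Or.inl hp⟩

theorem mem_interest_right {p : Fin K × Fin K} (hp : p ∈ V) : p.2 ∈ interest V := by
  simp only [interest, Finset.mem_filter, Finset.mem_univ, true_and]
  exact ⟨p.1, Or.inr hp⟩

theorem dfStar_pos (hq : 0 < q) (h : Testable V c) : 0 < dfStar q V c := by
  obtain ⟨h1, k, hk, h2⟩ := h
  have : 0 < ∑ k ∈ interest V, (((cluster c k).card : ℝ) - 1) := by
    refine Finset.sum_pos' (fun k hk => ?_) ⟨k, hk, ?_⟩
    · have : (1 : ℝ) ≤ (cluster c k).card := by exact_mod_cast (h1 k hk).card_pos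
      linarith
    · have : (2 : ℝ) ≤ (cluster c k).card := by exact_mod_cast h2
      linarith
  rw [Finset.sum_sub_distrib] at this
  simp only [Finset.sum_const, nsmul_eq_mul, mul_one] at this
  rw [dfStar]
  have hq' : (0 : ℝ) < q := by exact_mod_cast hq
  positivity

theorem df_pos (hq : 0 < q) (hV : ∀ p ∈ V, p.1 < p.2) (h : Testable V c) : 0 < df q V c := by
  obtain ⟨h1, k, hk, h2⟩ := h
  obtain ⟨p, hp⟩ : ∃ p, p ∈ V := by
    simp only [interest, Finset.mem_filter, Finset.mem_univ, true_and] at hk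
    obtain ⟨k', h | h⟩ := hk <;> exact ⟨_, h⟩
  -- At an index of cluster `p.1` the contrast equals the inverse size of that cluster, because `p.1
  -- ≠ p.2`.
  have hne : contrast c p.1 p.2 ≠ 0 := by
    obtain ⟨i, hi⟩ := h1 p.1 (mem_interest_left hp)
    intro h0
    have hi' : c i = p.1 := by simpa [cluster] using hi
    have h3 := congrArg (fun v : EuclideanSpace ℝ (Fin n) => v i) h0
    simp [contrast, indVec, hi', (hV p hp).ne] at h3
    rw [h3] at hi
    exact Finset.notMem_empty i hi
  have hmem : contrast c p.1 p.2 ∈ contrastSpace V c := Submodule.subset_span ⟨p, hp, rfl⟩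
  have : Nontrivial (contrastSpace V c) :=
    ⟨⟨⟨_, hmem⟩, 0, fun h => hne (congrArg Subtype.val h)⟩⟩
  have hpos : (0 : ℝ) < Module.finrank ℝ (contrastSpace V c) := by
    exact_mod_cast Module.finrank_pos
  have hq' : (0 : ℝ) < q := by exact_mod_cast hq
  rw [df]
  positivity

variable {μ : Matrix (Fin n) (Fin q) ℝ}

theorem NullHyp.const_on_pair (h : NullHyp μ V c) {p : Fin K × Fin K} (hp : p ∈ V) (l : Fin q) :
    ∃ a, ∀ i ∈ cluster c p.1 ∪ cluster c p.2, μ i l = a := by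
  by_cases hne : (cluster c p.1 ∪ cluster c p.2).Nonempty
  · obtain ⟨i₀, hi₀⟩ := hne
    exact ⟨μ i₀ l, fun i hi => congrFun (h p hp i hi i₀ hi₀) l⟩
  · rw [Finset.not_nonempty_iff_eq_empty] at hne
    exact ⟨0, fun i hi => by simp [hne] at hi⟩

theorem NullHyp.P1_mul (h : NullHyp μ V c) : P1 V c * μ = 0 := by
  ext i l
  have h1 : (P1 V c * μ) i l = (P1 V c *ᵥ fun j => μ j l) i := rfl
  rw [h1, P1_eq_sum, Matrix.sum_mulVec]
  rw [Finset.sum_eq_zero fun k hk => ?_]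
  · rfl
  simp only [interest, Finset.mem_filter, Finset.mem_univ, true_and] at hk
  obtain ⟨k', hk | hk⟩ := hk
  · obtain ⟨a, ha⟩ := h.const_on_pair hk l
    exact clusterCentering_mulVec_of_const c fun i hi => ha i (Finset.mem_union_left _ hi)
  · obtain ⟨a, ha⟩ := h.const_on_pair hk l
    exact clusterCentering_mulVec_of_const c fun i hi => ha i (Finset.mem_union_right _ hi)

theorem indVec_dotProduct_of_const {k : Fin K} {v : Fin n → ℝ} {a : ℝ}
    (hne : (cluster c k).Nonempty) (h : ∀ i ∈ cluster c k, v i = a) :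
    ((cluster c k).card : ℝ)⁻¹ * (indVec c k ⬝ᵥ v) = a := by
  have h0 : ((cluster c k).card : ℝ) ≠ 0 := by exact_mod_cast hne.card_ne_zero
  have h1 : indVec c k ⬝ᵥ v = ∑ i ∈ cluster c k, v i := by
    simp [dotProduct, indVec, cluster, Finset.sum_filter]
  rw [h1, Finset.sum_congr rfl h, Finset.sum_const, nsmul_eq_mul, inv_mul_cancel_left₀ h0]

/-- The inner product of a contrast with a column of `μ` is a difference of two cluster means, zero
under the null. An empty cluster would count as mean `0` and spoil this. -/
theorem NullHyp.PE_mul (h : NullHyp μ V c) (hne : ∀ k ∈ interest V, (cluster c k).Nonempty) :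
    PE V c * μ = 0 := by
  ext i l
  have h1 : (PE V c * μ) i l = (WithLp.toLp 2 (PE V c *ᵥ fun j => μ j l)) i := rfl
  rw [h1, toLp_PE_mulVec, (Submodule.starProjection_apply_eq_zero_iff _).2 ?_]
  · rfl
  rw [Submodule.mem_orthogonal]
  intro u hu
  induction hu using Submodule.span_induction with
  | mem x hx =>
    obtain ⟨p, hp, rfl⟩ := hx
    obtain ⟨a, ha⟩ := h.const_on_pair hp l
    have e1 := indVec_dotProduct_of_const (hne _ (mem_interest_left hp)) fun i hi =>
      ha i (Finset.mem_union_left _ hi)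
    have e2 := indVec_dotProduct_of_const (hne _ (mem_interest_right hp)) fun i hi =>
      ha i (Finset.mem_union_right _ hi)
    rw [EuclideanSpace.inner_eq_star_dotProduct]
    simp only [contrast, star_trivial, dotProduct_sub, dotProduct_smul, smul_eq_mul]
    rw [dotProduct_comm _ (indVec c p.1), dotProduct_comm _ (indVec c p.2), e1, e2, sub_self]
  | zero => simp
  | add x y _ _ hx hy => rw [inner_add_left, hx, hy, add_zero]
  | smul a x _ hx => rw [inner_smul_left, hx, mul_zero]

end Projections
end ClusterInference

/-! ### Joint law of `Z*` and `T*` for fixed clusters. -/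

instance Matrix.instBorelSpaceReal {m q : ℕ} : BorelSpace (Matrix (Fin m) (Fin q) ℝ) :=
  inferInstanceAs (BorelSpace (Fin m → Fin q → ℝ))

instance Matrix.instSecondCountableTopologyReal {m q : ℕ} :
    SecondCountableTopology (Matrix (Fin m) (Fin q) ℝ) :=
  inferInstanceAs (SecondCountableTopology (Fin m → Fin q → ℝ))

namespace ClusterInference
section Law

variable {Ω : Type*} [MeasurableSpace Ω] {P : Measure Ω} [IsProbabilityMeasure P] {n q : ℕ}
  {μ : Matrix (Fin n) (Fin q) ℝ} {σ : ℝ} {X : Ω → Matrix (Fin n) (Fin q) ℝ}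

theorem hasLaw_standardized_row {x : Ω → Fin q → ℝ} {m : Fin q → ℝ} (hσ : 0 < σ)
    (hx : HasLaw (fun ω => WithLp.toLp 2 (x ω))
      (multivariateGaussian (WithLp.toLp 2 m) (σ ^ 2 • (1 : Matrix (Fin q) (Fin q) ℝ))) P) :
    HasLaw (fun ω => WithLp.toLp 2 (σ⁻¹ • (x ω - m))) (stdGaussian (EuclideanSpace ℝ (Fin q)))
      P := by
  have hm : AEMeasurable (fun ω => WithLp.toLp 2 (σ⁻¹ • (x ω - m))) P := by
    have h := (hx.aemeasurable.sub_const (WithLp.toLp 2 m)).const_smul σ⁻¹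
    exact h
  refine ⟨hm, ?_⟩
  have hp : IsProbabilityMeasure (P.map (fun ω => WithLp.toLp 2 (σ⁻¹ • (x ω - m)))) :=
    Measure.isProbabilityMeasure_map hm
  refine Measure.ext_of_charFun ?_
  ext t
  have hps : (σ ^ 2 • (1 : Matrix (Fin q) (Fin q) ℝ)).PosSemidef :=
    Matrix.PosSemidef.one.smul (sq_nonneg σ)
  have h1 := charFun_multivariateGaussian (μ := WithLp.toLp 2 m) hps (σ⁻¹ • t)
  rw [← hx.map_eq, charFun_apply, integral_map hx.aemeasurable (by fun_prop)] at h1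
  rw [charFun_stdGaussian, charFun_apply, integral_map hm (by fun_prop)]
  have h2 : ∀ ω, Complex.exp (inner ℝ (WithLp.toLp 2 (σ⁻¹ • (x ω - m))) t * Complex.I) =
      Complex.exp (-(inner ℝ (σ⁻¹ • t) (WithLp.toLp 2 m) * Complex.I)) *
        Complex.exp (inner ℝ (WithLp.toLp 2 (x ω)) (σ⁻¹ • t) * Complex.I) := by
    intro ω
    rw [← Complex.exp_add]
    congr 1
    rw [WithLp.toLp_smul, WithLp.toLp_sub, inner_smul_left, inner_sub_left, inner_smul_left,
      inner_smul_right, real_inner_comm t (WithLp.toLp 2 m)]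
    simp
    ring
  simp_rw [h2]
  rw [integral_const_mul, h1, ← Complex.exp_add]
  congr 1
  have h3 : (σ⁻¹ • t).ofLp ⬝ᵥ (σ ^ 2 • (1 : Matrix (Fin q) (Fin q) ℝ)) *ᵥ (σ⁻¹ • t).ofLp =
      ‖t‖ ^ 2 := by
    rw [Matrix.smul_mulVec, Matrix.one_mulVec, EuclideanSpace.real_norm_sq_eq]
    simp only [WithLp.ofLp_smul, dotProduct_smul, smul_dotProduct, smul_eq_mul]
    rw [dotProduct]
    field_simp
  have h4 : (((σ⁻¹ • t).ofLp ⬝ᵥ (σ ^ 2 • (1 : Matrix (Fin q) (Fin q) ℝ)) *ᵥ (σ⁻¹ • t).ofLp : ℝ) :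
      ℂ) = (‖t‖ : ℂ) ^ 2 := by rw [h3]; push_cast; rfl
  rw [h4]
  ring

/-- By independence the characteristic function of the stacked vector is the product of those of the
rows, and the squared norms of the rows of `t` add up in the exponent. -/
theorem hasLaw_standardized (hσ : 0 < σ) (hX : Measurable X)
    (hindep : iIndepFun (fun i ω => X ω i) P)
    (hlaw : ∀ i, HasLaw (fun ω => WithLp.toLp 2 (X ω i))
      (multivariateGaussian (WithLp.toLp 2 (μ i)) (σ ^ 2 • (1 : Matrix (Fin q) (Fin q) ℝ))) P) :
    HasLaw (fun ω => (σ⁻¹ • (X ω - μ)).toEuclideanVec)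
      (stdGaussian (EuclideanSpace ℝ (Fin n × Fin q))) P := by
  have hm : Measurable fun ω => (σ⁻¹ • (X ω - μ)).toEuclideanVec :=
    Matrix.measurable_toEuclideanVec.comp ((hX.sub_const μ).const_smul σ⁻¹)
  have hrow : ∀ i, Measurable fun ω => X ω i := fun i => (measurable_pi_apply i).comp hX
  refine ⟨hm.aemeasurable, ?_⟩
  have hp : IsProbabilityMeasure (P.map fun ω => (σ⁻¹ • (X ω - μ)).toEuclideanVec) :=
    Measure.isProbabilityMeasure_map hm.aemeasurable
  refine Measure.ext_of_charFun ?_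
  ext t
  have hW : ∀ i, HasLaw (fun ω => WithLp.toLp 2 (σ⁻¹ • (X ω i - μ i)))
      (stdGaussian (EuclideanSpace ℝ (Fin q))) P := fun i => hasLaw_standardized_row hσ (hlaw i)
  have hWm : ∀ i, Measurable fun ω => WithLp.toLp 2 (σ⁻¹ • (X ω i - μ i)) := fun i =>
    (WithLp.measurable_toLp 2 _).comp (((hrow i).sub_const (μ i)).const_smul σ⁻¹)
  have hind : iIndepFun (fun i ω => WithLp.toLp 2 (σ⁻¹ • (X ω i - μ i))) P :=
    hindep.comp (fun i x => WithLp.toLp 2 (σ⁻¹ • (x - μ i)))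
      (fun i => (WithLp.measurable_toLp 2 _).comp ((measurable_id.sub_const (μ i)).const_smul σ⁻¹))
  have hch := (iIndepFun_iff_charFun_pi fun i => (hWm i).aemeasurable).1 hind
    (WithLp.toLp 2 fun i => WithLp.toLp 2 fun l => t (i, l))
  rw [charFun_apply, integral_map (by fun_prop) (by fun_prop)] at hch
  rw [charFun_stdGaussian, charFun_apply, integral_map hm.aemeasurable (by fun_prop)]
  have hin : ∀ ω, inner ℝ (σ⁻¹ • (X ω - μ)).toEuclideanVec t =
      inner ℝ (WithLp.toLp 2 fun i => WithLp.toLp 2 (σ⁻¹ • (X ω i - μ i)) :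
        PiLp 2 fun _ : Fin n => EuclideanSpace ℝ (Fin q))
        (WithLp.toLp 2 fun i => WithLp.toLp 2 fun l => t (i, l)) := by
    intro ω
    simp [PiLp.inner_apply, Fintype.sum_prod_type]
  simp_rw [hin]
  rw [hch]
  simp_rw [(hW _).map_eq, charFun_stdGaussian]
  rw [← Complex.exp_sum, ← Finset.sum_div, Finset.sum_neg_distrib]
  congr 3
  rw [← Complex.ofReal_pow, EuclideanSpace.real_norm_sq_eq, Fintype.sum_prod_type]
  push_cast
  refine Finset.sum_congr rfl fun i _ => ?_
  rw [← Complex.ofReal_pow, EuclideanSpace.real_norm_sq_eq]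
  simp

variable {K : ℕ} {V : Finset (Fin K × Fin K)} {c : Fin n → Fin K}

theorem measurable_matrix_mul_left (Q : Matrix (Fin n) (Fin n) ℝ) :
    Measurable fun A : Matrix (Fin n) (Fin q) ℝ => Q * A :=
  (continuous_const.matrix_mul continuous_id).measurable

theorem measurable_frobenius_norm : Measurable fun A : Matrix (Fin n) (Fin q) ℝ => ‖A‖ := by
  simp_rw [← Matrix.norm_toEuclideanVec]
  exact Matrix.measurable_toEuclideanVec.norm

theorem measurable_Tstar : Measurable (Tstar V c : Matrix (Fin n) (Fin q) ℝ → ℝ) := by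
  have h1 := measurable_frobenius_norm.comp (measurable_matrix_mul_left (q := q) (PE V c))
  have h2 := measurable_frobenius_norm.comp (measurable_matrix_mul_left (q := q) (P1 V c))
  exact ((h1.pow_const 2).div_const _).div ((h2.pow_const 2).div_const _)

theorem measurable_Zstar : Measurable (Zstar (q := q) V c) := by
  have h1 := measurable_matrix_mul_left (q := q) (PE V c)
  have h2 := measurable_matrix_mul_left (q := q) (P1 V c)
  have h3 := measurable_frobenius_norm.comp h1
  have h4 := measurable_frobenius_norm.comp h2
  exact (h3.inv.smul h1).prodMk ((h4.inv.smul h2).prodMk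
    (((h3.pow_const 2).add (h4.pow_const 2)).prodMk (measurable_matrix_mul_left _)))

/-- For a fixed assignment whose clusters satisfy the null hypothesis, the test statistic has an
`F` distribution and is independent of `Z*`. -/
theorem map_Zstar_Tstar (hq : 0 < q) (hσ : 0 < σ) (hX : Measurable X)
    (hindep : iIndepFun (fun i ω => X ω i) P)
    (hlaw : ∀ i, HasLaw (fun ω => WithLp.toLp 2 (X ω i))
      (multivariateGaussian (WithLp.toLp 2 (μ i)) (σ ^ 2 • (1 : Matrix (Fin q) (Fin q) ℝ))) P)
    (hV : ∀ p ∈ V, p.1 < p.2) (hnull : NullHyp μ V c) (htest : Testable V c) :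
    (∃ κ : Measure (Matrix (Fin n) (Fin q) ℝ × Matrix (Fin n) (Fin q) ℝ × ℝ ×
        Matrix (Fin n) (Fin q) ℝ), IsProbabilityMeasure κ ∧
      P.map (fun ω => (Zstar V c (X ω), Tstar V c (X ω))) =
        κ.prod (FDist (df q V c) (dfStar q V c))) ∧
    ∀ᵐ ω ∂P, PE V c * X ω ≠ 0 ∧ P1 V c * X ω ≠ 0 := by
  have hL := hasLaw_standardized hσ hX hindep hlaw
  have hm : Measurable fun ω => (σ⁻¹ • (X ω - μ)).toEuclideanVec :=
    Matrix.measurable_toEuclideanVec.comp ((hX.sub_const μ).const_smul σ⁻¹)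
  have hd := df_pos hq hV htest
  have hd' := dfStar_pos hq htest
  have hdf := df_eq_finrank (q := q) V c
  have hdf' := dfStar_eq_finrank (q := q) htest.1
  have hfd := isProbabilityMeasure_FDist hd hd'
  have hU : 0 < Module.finrank ℝ ((PE V c).leftRange q) := by exact_mod_cast hdf ▸ hd
  have hW : 0 < Module.finrank ℝ ((P1 V c).leftRange q) := by exact_mod_cast hdf' ▸ hd'
  -- The null hypothesis enters here and in `hWp`: the unknown mean drops out of both projections.
  have hUp : ∀ ω, ((PE V c).leftRange q).starProjection (σ⁻¹ • (X ω - μ)).toEuclideanVec =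
      (σ⁻¹ • (PE V c * X ω)).toEuclideanVec := fun ω => by
    rw [(isStarProjection_PE V c).starProjection_leftRange, Matrix.mul_smul, Matrix.mul_sub,
      hnull.PE_mul htest.1, sub_zero]
  have hWp : ∀ ω, ((P1 V c).leftRange q).starProjection (σ⁻¹ • (X ω - μ)).toEuclideanVec =
      (σ⁻¹ • (P1 V c * X ω)).toEuclideanVec := fun ω => by
    rw [(isStarProjection_P1 V c).starProjection_leftRange, Matrix.mul_smul, Matrix.mul_sub,
      hnull.P1_mul, sub_zero]
  have hσi : 0 < σ⁻¹ := inv_pos.2 hσ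
  constructor
  · obtain ⟨κ, hκ, h⟩ := stdGaussian_map_FRatio
      (Matrix.isOrtho_leftRange (q := q) (isStarProjection_PE V c) (PE_mul_P1 V c)) hU hW
    rw [← hdf, ← hdf', ← hL.map_eq, Measure.map_map (by fun_prop) hm] at h
    -- `g` undoes the standardisation. Directions are scale-free, the sum of squares gains `σ ^ 2`,
    -- and all of `μ` sits in the remainder. The ratio needs no correction.
    set g : EuclideanSpace ℝ (Fin n × Fin q) × EuclideanSpace ℝ (Fin n × Fin q) × ℝ ×
        EuclideanSpace ℝ (Fin n × Fin q) → Matrix (Fin n) (Fin q) ℝ × Matrix (Fin n) (Fin q) ℝ ×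
        ℝ × Matrix (Fin n) (Fin q) ℝ := fun z =>
      (Matrix.ofEuclideanVec z.1, Matrix.ofEuclideanVec z.2.1, σ ^ 2 * z.2.2.1,
        σ • Matrix.ofEuclideanVec z.2.2.2 + μ) with hg
    have hgm : Measurable g := by
      have := Matrix.measurable_ofEuclideanVec (m := n) (q := q)
      fun_prop
    refine ⟨κ.map g, Measure.isProbabilityMeasure_map hgm.aemeasurable, ?_⟩
    rw [← Measure.map_id (μ := FDist (df q V c) (dfStar q V c)),
      Measure.map_prod_map _ _ hgm measurable_id, ← h,
      Measure.map_map (hgm.prodMap measurable_id)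
        (Measurable.comp (by fun_prop) hm)]
    congr 1
    ext1 ω
    simp only [Function.comp_apply, Prod.map, hUp, hWp, id_eq, Matrix.norm_toEuclideanVec, hg]
    simp only [← map_smul, ← map_sub, Matrix.ofEuclideanVec_toEuclideanVec, norm_smul,
      Real.norm_eq_abs, abs_of_pos hσi, Zstar, Tstar, smul_smul]
    refine Prod.ext (Prod.ext ?_ (Prod.ext ?_ (Prod.ext ?_ ?_))) ?_
    · simp only
      congr 1
      field_simp
    · simp only
      congr 1
      field_simp
    · simp only
      field_simp
    · simp only [P2]
      rw [Matrix.sub_mul, Matrix.sub_mul, Matrix.one_mul, smul_sub, smul_sub, smul_smul, smul_smul,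
        smul_smul, mul_inv_cancel₀ hσ.ne', one_smul, one_smul, one_smul]
      abel
    · simp only
      field_simp
  · have h1 := ae_starProjection_stdGaussian_ne_zero hU
    have h2 := ae_starProjection_stdGaussian_ne_zero hW
    rw [← hL.map_eq] at h1 h2
    filter_upwards [ae_of_ae_map hL.aemeasurable h1, ae_of_ae_map hL.aemeasurable h2] with ω h1 h2
    rw [hUp] at h1
    rw [hWp] at h2
    exact ⟨fun h0 => h1 (by rw [h0, smul_zero, map_zero]),
      fun h0 => h2 (by rw [h0, smul_zero, map_zero])⟩

end Law
end ClusterInference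

/-! ### Probability integral transform. -/

section ProbabilityIntegralTransform

open Filter Topology

theorem continuous_cdf (ν : Measure ℝ) [IsProbabilityMeasure ν] [NullSingletonClass ν] :
    Continuous (cdf ν) := by
  refine continuous_iff_continuousAt.2 fun x => ?_
  rw [(monotone_cdf ν).continuousAt_iff_leftLim_eq_rightLim, StieltjesFunction.rightLim_eq]
  have h := (cdf ν).measure_singleton x
  rw [measure_cdf, measure_singleton] at h
  have h1 := ENNReal.ofReal_eq_zero.1 h.symm
  have h2 := (monotone_cdf ν).leftLim_le (le_refl x)
  linarith

/-- The probability integral transform, for the survival function of an atomless law. -/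
theorem map_one_sub_cdf (ν : Measure ℝ) [IsProbabilityMeasure ν] [NullSingletonClass ν] :
    ν.map (fun t => 1 - cdf ν t) = volume.restrict (Set.Icc 0 1) := by
  have hc := continuous_cdf ν
  have hm : Measurable fun t => 1 - cdf ν t := (continuous_const.sub hc).measurable
  have : IsProbabilityMeasure (ν.map fun t => 1 - cdf ν t) :=
    Measure.isProbabilityMeasure_map hm.aemeasurable
  refine Measure.ext_of_Iic _ _ fun a => ?_
  rw [Measure.map_apply hm measurableSet_Iic, Measure.restrict_apply measurableSet_Iic]
  rcases lt_or_ge a 0 with ha | ha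
  · rw [show (fun t => 1 - cdf ν t) ⁻¹' Set.Iic a = ∅ by
      ext t
      have := cdf_le_one ν t
      simp only [Set.mem_preimage, Set.mem_Iic, Set.mem_empty_iff_false, iff_false]
      linarith, show Set.Iic a ∩ Set.Icc 0 1 = ∅ by
      ext t
      simp only [Set.mem_inter_iff, Set.mem_Iic, Set.mem_Icc, Set.mem_empty_iff_false, iff_false]
      rintro ⟨h1, h2, -⟩
      linarith]
    simp
  rcases le_or_gt 1 a with ha1 | ha1
  · rw [show (fun t => 1 - cdf ν t) ⁻¹' Set.Iic a = Set.univ by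
      ext t
      have := cdf_nonneg ν t
      simp only [Set.mem_preimage, Set.mem_Iic, Set.mem_univ, iff_true]
      linarith, show Set.Iic a ∩ Set.Icc 0 1 = Set.Icc 0 1 by
      ext t
      simp only [Set.mem_inter_iff, Set.mem_Iic, Set.mem_Icc, and_iff_right_iff_imp]
      rintro ⟨-, h2⟩
      linarith]
    simp
  have hvol : Set.Iic a ∩ Set.Icc 0 1 = Set.Icc 0 a := by
    ext t
    simp only [Set.mem_inter_iff, Set.mem_Iic, Set.mem_Icc]
    exact ⟨fun h => ⟨h.2.1, h.1⟩, fun h => ⟨h.2, h.1, h.2.trans ha1.le⟩⟩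
  rw [hvol, Real.volume_Icc, sub_zero]
  set S : Set ℝ := (fun t => 1 - cdf ν t) ⁻¹' Set.Iic a with hS
  have hmem : ∀ t, t ∈ S ↔ 1 - a ≤ cdf ν t := fun t => by
    simp only [hS, Set.mem_preimage, Set.mem_Iic]
    constructor <;> intro h <;> linarith
  -- If `S` is empty, the distribution function stays below `1 - a` while tending to `1`, which
  -- forces `a = 0`. Otherwise `S` is a closed half-line `[x, ∞)`, and continuity at `x` gives the
  -- value `1 - a` there.
  rcases S.eq_empty_or_nonempty with hne | hne
  · have h0 : a = 0 := by
      refine le_antisymm ?_ ha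
      have h1 : 1 ≤ 1 - a := le_of_tendsto (tendsto_cdf_atTop ν) (Eventually.of_forall fun t => by
        by_contra! hlt
        have : t ∈ S := (hmem t).2 hlt.le
        rw [hne] at this
        exact this)
      linarith
    simp [hne, h0]
  · have hbdd : BddBelow S := by
      obtain ⟨t₀, ht₀⟩ := ((tendsto_cdf_atBot ν).eventually_lt_const
        (show 0 < 1 - a by linarith)).exists
      refine ⟨t₀, fun t ht => ?_⟩
      by_contra! hlt
      have h1 := monotone_cdf ν hlt.le
      have h2 := (hmem t).1 ht
      linarith
    have hcl : IsClosed S := isClosed_Iic.preimage (continuous_const.sub hc)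
    set x := sInf S with hx
    have hxS : x ∈ S := hcl.csInf_mem hne hbdd
    have hSI : S = Set.Ici x := by
      ext t
      refine ⟨fun ht => csInf_le hbdd ht, fun ht => (hmem t).2 ?_⟩
      exact ((hmem x).1 hxS).trans (monotone_cdf ν ht)
    have hle : cdf ν x ≤ 1 - a := by
      refine le_of_tendsto (hc.continuousAt.tendsto.mono_left
        (nhdsWithin_le_nhds (s := Set.Iio x))) ?_
      filter_upwards [self_mem_nhdsWithin] with t ht
      by_contra! hlt
      exact absurd (csInf_le hbdd ((hmem t).2 hlt.le)) (not_le.2 ht)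
    have heq : cdf ν x = 1 - a := le_antisymm hle ((hmem x).1 hxS)
    rw [hSI, ← Set.compl_Iio, prob_compl_eq_one_sub measurableSet_Iio,
      measure_congr Iio_ae_eq_Iic, ← ofReal_cdf, heq, ← ENNReal.ofReal_one,
      ← ENNReal.ofReal_sub _ (by linarith)]
    congr 1
    ring

end ProbabilityIntegralTransform

/-! ### Conditioning on a selection event, and uniformity of the p-value. -/

section Selection

variable {Ω 𝓚 𝓩 : Type*} [MeasurableSpace Ω] [MeasurableSpace 𝓚] [MeasurableSingletonClass 𝓚]
  [MeasurableSpace 𝓩] {P : Measure Ω} [IsProbabilityMeasure P]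

/-- The kernel that truncates a law to the sections of a set. -/
noncomputable def truncationKernel (F : Measure ℝ) [IsProbabilityMeasure F] {D : Set (𝓩 × ℝ)}
    (hD : MeasurableSet D) : Kernel 𝓩 ℝ where
  toFun z := ProbabilityTheory.cond F (Prod.mk z ⁻¹' D)
  measurable' := by
    refine Measure.measurable_of_measurable_coe _ fun s hs => ?_
    have h : ∀ z, ProbabilityTheory.cond F (Prod.mk z ⁻¹' D) s =
        (F (Prod.mk z ⁻¹' D))⁻¹ * F (Prod.mk z ⁻¹' (D ∩ Prod.snd ⁻¹' s)) := fun z =>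
      cond_apply (measurable_prodMk_left hD) _ _
    simp_rw [h]
    exact (measurable_measure_prodMk_left hD).inv.mul
      (measurable_measure_prodMk_left (hD.inter (measurable_snd hs)))

/-- The kernel need not be Markov: truncation to an `F`-null section gives the zero measure. -/
instance isFiniteKernel_truncationKernel (F : Measure ℝ) [IsProbabilityMeasure F]
    {D : Set (𝓩 × ℝ)} (hD : MeasurableSet D) : IsFiniteKernel (truncationKernel F hD) := by
  refine ⟨1, ENNReal.one_lt_top, fun z => ?_⟩
  change ProbabilityTheory.cond F (Prod.mk z ⁻¹' D) Set.univ ≤ 1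
  rw [cond_apply (measurable_prodMk_left hD), Set.inter_univ]
  exact ENNReal.inv_mul_le_one _

/-- If `T` is independent of `Z` with law `F`, and selecting `C` amounts to `(Z, T) ∈ D`, then the
conditional law of `T` given `Z` and the selection is `F` truncated to the section of `D`. -/
theorem condDistrib_of_selection {k : Ω → 𝓚} {Y : Ω → 𝓚 × 𝓩} {T' : Ω → ℝ} (hY : Measurable Y)
    (hT' : Measurable T') (hk : ∀ ω, (Y ω).1 = k ω) {C : 𝓚} {Z : Ω → 𝓩} {T : Ω → ℝ}
    (hZ : Measurable Z) (hT : Measurable T) (hYC : ∀ ω, k ω = C → Y ω = (C, Z ω))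
    (hTC : ∀ ω, k ω = C → T' ω = T ω) {κ : Measure 𝓩} [IsProbabilityMeasure κ] {F : Measure ℝ}
    [IsProbabilityMeasure F] (hjoint : P.map (fun ω => (Z ω, T ω)) = κ.prod F)
    {D : Set (𝓩 × ℝ)} (hD : MeasurableSet D) (hsel : ∀ᵐ ω ∂P, k ω = C ↔ (Z ω, T ω) ∈ D) :
    ∀ᵐ y ∂(P.map Y), y.1 = C →
      condDistrib T' Y P y = ProbabilityTheory.cond F (Prod.mk y.2 ⁻¹' D) := by
  set B : Set (𝓚 × 𝓩) := Prod.fst ⁻¹' {C} with hB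
  have hBm : MeasurableSet B := measurable_fst (measurableSet_singleton C)
  have hp : IsProbabilityMeasure (P.map Y) := Measure.isProbabilityMeasure_map hY.aemeasurable
  set η : Kernel (𝓚 × 𝓩) ℝ := (truncationKernel F hD).comap Prod.snd measurable_snd
  -- Kernels with equal composition products over the law of `Y` restricted to `B` agree almost
  -- everywhere on `B`. There `Y` and `T'` may be replaced by `(C, Z)` and `T`, and the selection by
  -- `D`, so that both sides become integrals against `κ`.
  have key : ((P.map Y).restrict B) ⊗ₘ (condDistrib T' Y P) = ((P.map Y).restrict B) ⊗ₘ η := by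
    ext E hE
    have hEC : MeasurableSet {p : 𝓩 × ℝ | ((C, p.1), p.2) ∈ E} := by
      have : Measurable fun p : 𝓩 × ℝ => (((C, p.1), p.2) : (𝓚 × 𝓩) × ℝ) := by fun_prop
      exact this hE
    set EC : Set (𝓩 × ℝ) := {p | ((C, p.1), p.2) ∈ E}
    have hl : (((P.map Y).restrict B) ⊗ₘ (condDistrib T' Y P)) E =
        ∫⁻ z, F (Prod.mk z ⁻¹' (D ∩ EC)) ∂κ := by
      have h1 : (((P.map Y).restrict B) ⊗ₘ (condDistrib T' Y P)) E =
          ((P.map Y) ⊗ₘ (condDistrib T' Y P)) (E ∩ Prod.fst ⁻¹' B) := by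
        rw [Measure.compProd_apply hE, Measure.compProd_apply (hE.inter (measurable_fst hBm)),
          ← lintegral_indicator hBm]
        refine lintegral_congr fun y => ?_
        by_cases hy : y ∈ B
        · rw [Set.indicator_of_mem hy]
          congr 1
          ext t
          simp [hy]
        · rw [Set.indicator_of_notMem hy]
          symm
          convert measure_empty (μ := condDistrib T' Y P y)
          ext t
          simp [hy]
      rw [h1, compProd_map_condDistrib hT'.aemeasurable,
        Measure.map_apply (by fun_prop) (hE.inter (measurable_fst hBm)),
        ← Measure.prod_apply (hD.inter hEC), ← hjoint,
        Measure.map_apply (by fun_prop) (hD.inter hEC)]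
      refine measure_congr ?_
      filter_upwards [hsel] with ω hω
      apply propext
      change ((Y ω, T' ω) ∈ E ∧ (Y ω).1 = C) ↔ ((Z ω, T ω) ∈ D ∧ ((C, Z ω), T ω) ∈ E)
      rw [hk, ← hω]
      constructor
      · rintro ⟨h1, h2⟩
        rw [hYC ω h2, hTC ω h2] at h1
        exact ⟨h2, h1⟩
      · rintro ⟨h1, h2⟩
        rw [hYC ω h1, hTC ω h1]
        exact ⟨h2, h1⟩
    have hgm : Measurable fun z => truncationKernel F hD z (Prod.mk z ⁻¹' EC) :=
      Kernel.measurable_kernel_prodMk_left hEC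
    have hr : (((P.map Y).restrict B) ⊗ₘ η) E =
        ∫⁻ z, truncationKernel F hD z (Prod.mk z ⁻¹' EC) * F (Prod.mk z ⁻¹' D) ∂κ := by
      have h2 : Measurable fun y => η y (Prod.mk y ⁻¹' E) := Kernel.measurable_kernel_prodMk_left hE
      rw [Measure.compProd_apply hE, ← lintegral_indicator hBm,
        lintegral_map (h2.indicator hBm) hY]
      have h3 : ∫⁻ ω, B.indicator (fun y => η y (Prod.mk y ⁻¹' E)) (Y ω) ∂P =
          ∫⁻ ω, D.indicator (fun p => truncationKernel F hD p.1 (Prod.mk p.1 ⁻¹' EC))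
            (Z ω, T ω) ∂P := by
        refine lintegral_congr_ae ?_
        filter_upwards [hsel] with ω hω
        by_cases h : k ω = C
        · rw [Set.indicator_of_mem (show Y ω ∈ B from (hk ω).trans h),
            Set.indicator_of_mem (hω.1 h), hYC ω h]
          rfl
        · rw [Set.indicator_of_notMem (fun h' : Y ω ∈ B => h ((hk ω).symm.trans h')),
            Set.indicator_of_notMem (fun h' => h (hω.2 h'))]
      have h4 : Measurable (D.indicator fun p : 𝓩 × ℝ =>
          truncationKernel F hD p.1 (Prod.mk p.1 ⁻¹' EC)) :=
        (hgm.comp measurable_fst).indicator hD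
      rw [h3, ← lintegral_map h4 (by fun_prop : Measurable fun ω => (Z ω, T ω)), hjoint,
        lintegral_prod _ h4.aemeasurable]
      refine lintegral_congr fun z => ?_
      have h5 : ∀ t, D.indicator (fun p : 𝓩 × ℝ =>
          truncationKernel F hD p.1 (Prod.mk p.1 ⁻¹' EC)) (z, t) =
          (Prod.mk z ⁻¹' D).indicator
            (fun _ => truncationKernel F hD z (Prod.mk z ⁻¹' EC)) t := fun t => rfl
      simp_rw [h5]
      rw [lintegral_indicator_const (measurable_prodMk_left hD)]
    rw [hl, hr]
    refine lintegral_congr fun z => ?_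
    change _ = ProbabilityTheory.cond F (Prod.mk z ⁻¹' D) (Prod.mk z ⁻¹' EC) * _
    -- This identity holds for null sections as well, both sides being zero.
    rw [cond_mul_eq_inter (measurable_prodMk_left hD)]
    rfl
  have h := Kernel.ae_eq_of_compProd_eq key
  rw [Filter.EventuallyEq, ae_restrict_iff' hBm] at h
  exact h

theorem measurable_cdf_kernel {α : Type*} [MeasurableSpace α] {κ : Kernel α ℝ}
    [IsMarkovKernel κ] : Measurable fun p : α × ℝ => cdf (κ p.1) p.2 := by
  have h : MeasurableSet {p : (α × ℝ) × ℝ | p.2 ≤ p.1.2} :=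
    measurableSet_le measurable_snd (measurable_snd.comp measurable_fst)
  set η : Kernel (α × ℝ) ℝ := κ.comap Prod.fst measurable_fst
  have h1 := Kernel.measurable_kernel_prodMk_left (κ := η) h
  have h2 : (fun p : α × ℝ => cdf (κ p.1) p.2) =
      fun p : α × ℝ => (η p (Prod.mk p ⁻¹' {p | p.2 ≤ p.1.2})).toReal := by
    ext p
    rw [cdf_eq_real]
    rfl
  rw [h2]
  exact h1.ennreal_toReal

/-- For almost every `y ∈ B` the transform under `κ y` is uniform, a law that does not depend on
`y`; integrating over `B` yields the product. -/
theorem compProd_one_sub_cdf_preimage {α : Type*} [MeasurableSpace α] {ν : Measure α} [SFinite ν]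
    {κ : Kernel α ℝ} [IsMarkovKernel κ] {B : Set α} (hB : MeasurableSet B)
    (hatom : ∀ᵐ y ∂ν, y ∈ B → NullSingletonClass (κ y)) {s : Set ℝ} (hs : MeasurableSet s) :
    (ν ⊗ₘ κ) (Prod.fst ⁻¹' B ∩ (fun p : α × ℝ => 1 - cdf (κ p.1) p.2) ⁻¹' s) =
      volume.restrict (Set.Icc 0 1) s * ν B := by
  have hpm : Measurable fun p : α × ℝ => 1 - cdf (κ p.1) p.2 :=
    measurable_const.sub measurable_cdf_kernel
  rw [Measure.compProd_apply ((measurable_fst hB).inter (hpm hs)),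
    ← lintegral_indicator_const hB]
  refine lintegral_congr_ae ?_
  filter_upwards [hatom] with y hy
  by_cases h : y ∈ B
  · have := hy h
    have hym : Measurable fun t => 1 - cdf (κ y) t :=
      (continuous_const.sub (continuous_cdf (κ y))).measurable
    rw [Set.indicator_of_mem h, ← map_one_sub_cdf (κ y), Measure.map_apply hym hs]
    congr 1
    ext t
    simp [h]
  · rw [Set.indicator_of_notMem h]
    convert measure_empty (μ := κ y)
    ext t
    simp [h]

/-- The p-value computed from the conditional distribution function is uniform given a selection
for which the conditional law is atomless. -/
theorem map_cond_one_sub_cdf {α : Type*} [MeasurableSpace α] {Y : Ω → α} {T : Ω → ℝ}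
    (hY : Measurable Y) (hT : Measurable T) {κ : Kernel α ℝ} [IsMarkovKernel κ]
    (hκ : (P.map Y) ⊗ₘ κ = P.map (fun ω => (Y ω, T ω))) {B : Set α} (hB : MeasurableSet B)
    (hPB : P (Y ⁻¹' B) ≠ 0) (hatom : ∀ᵐ y ∂(P.map Y), y ∈ B → NullSingletonClass (κ y)) :
    (ProbabilityTheory.cond P (Y ⁻¹' B)).map (fun ω => 1 - cdf (κ (Y ω)) (T ω)) =
      volume.restrict (Set.Icc 0 1) := by
  have hp : IsProbabilityMeasure (P.map Y) := Measure.isProbabilityMeasure_map hY.aemeasurable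
  have hpm : Measurable fun p : α × ℝ => 1 - cdf (κ p.1) p.2 :=
    measurable_const.sub measurable_cdf_kernel
  have hYT : Measurable fun ω => (Y ω, T ω) := hY.prodMk hT
  have hYTm : Measurable fun ω => 1 - cdf (κ (Y ω)) (T ω) := by
    have h := hpm.comp hYT
    simpa only [Function.comp_def] using h
  ext s hs
  have h := compProd_one_sub_cdf_preimage (ν := P.map Y) hB hatom hs
  rw [hκ, Measure.map_apply hYT ((measurable_fst hB).inter (hpm hs)),
    Measure.map_apply hY hB] at h
  rw [Measure.map_apply hYTm hs, cond_apply (hY hB)]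
  have h1 : P (Y ⁻¹' B ∩ (fun ω => 1 - cdf (κ (Y ω)) (T ω)) ⁻¹' s) =
      volume.restrict (Set.Icc 0 1) s * P (Y ⁻¹' B) := h
  rw [h1, mul_comm, mul_assoc, ENNReal.mul_inv_cancel hPB (measure_ne_top _ _), mul_one]

end Selection

/-! ### Measurability of `K`-means. -/

namespace ClusterInference

section KMeansMeasurability

variable {n q K : ℕ}

theorem measurable_centers (c : Fin n → Fin K) :
    Measurable fun A : Matrix (Fin n) (Fin q) ℝ => centers A c := by
  refine measurable_pi_lambda _ fun l => ?_
  have h : Measurable fun A : Matrix (Fin n) (Fin q) ℝ => ∑ i ∈ cluster c l, A i :=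
    Finset.measurable_sum _ fun i _ => measurable_pi_apply i
  exact h.const_smul ((cluster c l).card : ℝ)⁻¹

variable [NeZero K]

/-- Reduces the choice with its tie rule to finitely many comparisons of distances, from which
measurability is read off. -/
theorem nearest_eq_iff (m : Matrix (Fin K) (Fin q) ℝ) (x : Fin q → ℝ) (k : Fin K) :
    nearest m x = k ↔
      (∀ l', ‖WithLp.toLp 2 (x - m k)‖ ≤ ‖WithLp.toLp 2 (x - m l')‖) ∧
      ∀ l < k, ∃ l', ‖WithLp.toLp 2 (x - m l')‖ < ‖WithLp.toLp 2 (x - m l)‖ := by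
  have hmem : ∀ l, l ∈ nearestSet m x ↔
      ∀ l', ‖WithLp.toLp 2 (x - m l)‖ ≤ ‖WithLp.toLp 2 (x - m l')‖ := fun l => by
    rw [nearestSet, Finset.mem_filter]
    exact and_iff_right (Finset.mem_univ l)
  constructor
  · rintro rfl
    refine ⟨(hmem _).1 (Finset.min'_mem _ _), fun l hl => ?_⟩
    by_contra! h
    exact absurd (Finset.min'_le _ l ((hmem l).2 h)) (not_le.2 hl)
  · rintro ⟨h1, h2⟩
    refine le_antisymm (Finset.min'_le _ k ((hmem k).2 h1)) ?_
    by_contra! hlt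
    obtain ⟨l', hl'⟩ := h2 _ hlt
    exact absurd ((hmem _).1 (Finset.min'_mem _ (nearestSet_nonempty m x)) l') (not_le.2 hl')

theorem measurable_nearest {α : Type*} [MeasurableSpace α] {m : α → Matrix (Fin K) (Fin q) ℝ}
    {x : α → Fin q → ℝ} (hm : Measurable m) (hx : Measurable x) :
    Measurable fun a => nearest (m a) (x a) := by
  have hd : ∀ l, Measurable fun a => ‖WithLp.toLp 2 (x a - m a l)‖ := fun l => by
    have h1 : Measurable fun a => m a l := (measurable_pi_apply l).comp hm
    exact ((WithLp.measurable_toLp 2 _).comp (hx.sub h1)).norm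
  refine measurable_to_countable' fun k => ?_
  have hset : (fun a => nearest (m a) (x a)) ⁻¹' {k} =
      (⋂ l', {a | ‖WithLp.toLp 2 (x a - m a k)‖ ≤ ‖WithLp.toLp 2 (x a - m a l')‖}) ∩
      ⋂ l, ⋂ (_ : l < k), ⋃ l',
        {a | ‖WithLp.toLp 2 (x a - m a l')‖ < ‖WithLp.toLp 2 (x a - m a l)‖} := by
    ext a
    simp [nearest_eq_iff]
  rw [hset]
  exact (MeasurableSet.iInter fun l' => measurableSet_le (hd k) (hd l')).inter
    (MeasurableSet.iInter fun l => MeasurableSet.iInter fun _ => MeasurableSet.iUnion fun l' =>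
      measurableSet_lt (hd l') (hd l))

variable {init : Matrix (Fin n) (Fin q) ℝ → Matrix (Fin K) (Fin q) ℝ}

theorem measurable_kmeansIter (hinit : Measurable init) (j : ℕ) :
    Measurable fun A => kmeansIter init A j := by
  induction j with
  | zero =>
    exact measurable_pi_lambda _ fun i => measurable_nearest hinit (measurable_pi_apply i)
  | succ j ih =>
    -- There are only finitely many assignments, so measurability in the data for each fixed
    -- assignment is enough.
    have h : Measurable fun p : Matrix (Fin n) (Fin q) ℝ × (Fin n → Fin K) =>
        fun i => nearest (centers p.1 p.2) (p.1 i) :=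
      measurable_from_prod_countable_left fun c => measurable_pi_lambda _ fun i =>
        measurable_nearest (measurable_centers c) (measurable_pi_apply i)
    have h1 := h.comp (measurable_id.prodMk ih)
    simp only [Function.comp_def] at h1
    exact h1

theorem measurable_kmeans (hinit : Measurable init) (J : ℕ) : Measurable (kmeans init J) :=
  measurable_pi_lambda _ fun j => measurable_kmeansIter hinit j

end KMeansMeasurability

/-! ### Recovering the data from `Z*` and `T*`. -/

section Reconstruction

variable {n q K : ℕ}

/-- The perturbed data `x*(ψ)` as a function of `Z*`. -/
noncomputable def reconstruct (r : ℝ) (z : Matrix (Fin n) (Fin q) ℝ × Matrix (Fin n) (Fin q) ℝ × ℝ ×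
    Matrix (Fin n) (Fin q) ℝ) (ψ : ℝ) : Matrix (Fin n) (Fin q) ℝ :=
  √z.2.2.1 • (√(ψ / (ψ + r)) • z.1 + √(r / (ψ + r)) • z.2.1) + z.2.2.2

theorem measurable_reconstruct (r : ℝ) :
    Measurable fun p : (Matrix (Fin n) (Fin q) ℝ × Matrix (Fin n) (Fin q) ℝ × ℝ ×
      Matrix (Fin n) (Fin q) ℝ) × ℝ => reconstruct r p.1 p.2 := by
  unfold reconstruct
  fun_prop

variable {V : Finset (Fin K × Fin K)} {c : Fin n → Fin K} {A : Matrix (Fin n) (Fin q) ℝ}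

theorem xstar_eq_reconstruct (ψ : ℝ) :
    xstar V c A ψ = reconstruct (dfStar q V c / df q V c) (Zstar V c A) ψ := rfl

theorem Tstar_nonneg (hd : 0 ≤ df q V c) (hd' : 0 ≤ dfStar q V c) : 0 ≤ Tstar V c A := by
  unfold Tstar
  positivity

/-- At `ψ = T*` the two weights `ψ / (ψ + r)` and `r / (ψ + r)` become the shares of the squared
norms in their sum, so each direction regains its length. Nonzero projections are needed for the
directions to be unit vectors. -/
theorem xstar_Tstar (hd : 0 < df q V c) (hd' : 0 < dfStar q V c) (h₁ : PE V c * A ≠ 0)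
    (h₂ : P1 V c * A ≠ 0) : xstar V c A (Tstar V c A) = A := by
  have ha : 0 < ‖PE V c * A‖ := norm_pos_iff.2 h₁
  have hb : 0 < ‖P1 V c * A‖ := norm_pos_iff.2 h₂
  have hA : PE V c * A + P1 V c * A + P2 V c * A = A := by
    rw [P2, Matrix.sub_mul, Matrix.sub_mul, Matrix.one_mul]
    abel
  conv_rhs => rw [← hA]
  simp only [xstar, Tstar]
  set a := ‖PE V c * A‖
  set b := ‖P1 V c * A‖
  set d := df q V c
  set d' := dfStar q V c
  have e1 : a ^ 2 / d / (b ^ 2 / d') / (a ^ 2 / d / (b ^ 2 / d') + d' / d) =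
      a ^ 2 / (a ^ 2 + b ^ 2) := by
    field_simp
  have e2 : d' / d / (a ^ 2 / d / (b ^ 2 / d') + d' / d) = b ^ 2 / (a ^ 2 + b ^ 2) := by
    field_simp
  have hs : 0 < √(a ^ 2 + b ^ 2) := Real.sqrt_pos.2 (by positivity)
  rw [e1, e2, Real.sqrt_div (sq_nonneg a), Real.sqrt_div (sq_nonneg b), Real.sqrt_sq ha.le,
    Real.sqrt_sq hb.le, smul_add, smul_smul, smul_smul, smul_smul, smul_smul,
    mul_assoc, mul_assoc,
    show √(a ^ 2 + b ^ 2) * (a / √(a ^ 2 + b ^ 2) * a⁻¹) = 1 by field_simp,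
    show √(a ^ 2 + b ^ 2) * (b / √(a ^ 2 + b ^ 2) * b⁻¹) = 1 by field_simp, one_smul, one_smul]

end Reconstruction

/-! ### Truncated `F` law of the test statistic, and the theorem. -/

section Main

variable {Ω : Type*} [MeasurableSpace Ω] {P : Measure Ω} [IsProbabilityMeasure P]
  {n q K : ℕ} [NeZero K] {μ : Matrix (Fin n) (Fin q) ℝ} {σ : ℝ}
  {X : Ω → Matrix (Fin n) (Fin q) ℝ} {init : Matrix (Fin n) (Fin q) ℝ → Matrix (Fin K) (Fin q) ℝ}
  {J : ℕ} {V : Finset (Fin K × Fin K)}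

theorem measurable_TstarRV (hX : Measurable X) (hinit : Measurable init) :
    Measurable (TstarRV init J V X) := by
  have h : Measurable fun p : Matrix (Fin n) (Fin q) ℝ × (Fin (J + 1) → Fin n → Fin K) =>
      Tstar V (final p.2) p.1 := measurable_from_prod_countable_left fun C => measurable_Tstar
  have h1 := h.comp (hX.prodMk ((measurable_kmeans hinit J).comp hX))
  simp only [Function.comp_def] at h1
  exact h1

theorem measurable_condRV (hX : Measurable X) (hinit : Measurable init) :
    Measurable (condRV init J V X) := by
  have h : Measurable fun p : Matrix (Fin n) (Fin q) ℝ × (Fin (J + 1) → Fin n → Fin K) =>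
      Zstar V (final p.2) p.1 := measurable_from_prod_countable_left fun C => measurable_Zstar
  have hk := (measurable_kmeans hinit J).comp hX
  have h1 := hk.prodMk (h.comp (hX.prodMk hk))
  simp only [Function.comp_def] at h1
  exact h1

theorem measurableSet_reconstruct (hinit : Measurable init) (r : ℝ)
    (C : Fin (J + 1) → Fin n → Fin K) :
    MeasurableSet {p : (Matrix (Fin n) (Fin q) ℝ × Matrix (Fin n) (Fin q) ℝ × ℝ ×
      Matrix (Fin n) (Fin q) ℝ) × ℝ | 0 ≤ p.2 ∧ C = kmeans init J (reconstruct r p.1 p.2)} := by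
  have h := ((measurable_kmeans hinit J).comp (measurable_reconstruct r))
    (measurableSet_singleton C)
  simp only [Set.preimage, Function.comp_def, Set.mem_singleton_iff, eq_comm (b := C)] at h
  exact (measurableSet_le measurable_const measurable_snd).inter h

/-- Given an outcome whose clusters satisfy the null hypothesis and `Z*`, the test statistic has a
truncated `F` distribution. -/
theorem condDistrib_TstarRV (hq : 0 < q) (hσ : 0 < σ) (hX : Measurable X)
    (hindep : iIndepFun (fun i ω => X ω i) P)
    (hlaw : ∀ i, HasLaw (fun ω => WithLp.toLp 2 (X ω i))
      (multivariateGaussian (WithLp.toLp 2 (μ i)) (σ ^ 2 • (1 : Matrix (Fin q) (Fin q) ℝ))) P)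
    (hinit : Measurable init) (hV : ∀ p ∈ V, p.1 < p.2) (C : Fin (J + 1) → Fin n → Fin K)
    (hnull : NullHyp μ V (final C)) (htest : Testable V (final C)) :
    ∀ᵐ y ∂(P.map (condRV init J V X)), y.1 = C →
      condDistrib (TstarRV init J V X) (condRV init J V X) P y =
        ProbabilityTheory.cond (FDist (df q V (final C)) (dfStar q V (final C)))
          {ψ | 0 ≤ ψ ∧ C = kmeans init J
            (reconstruct (dfStar q V (final C) / df q V (final C)) y.2 ψ)} := by
  have hd := df_pos hq hV htest
  have hd' := dfStar_pos hq htest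
  have hF := isProbabilityMeasure_FDist hd hd'
  obtain ⟨⟨κ, hκ, hjoint⟩, hne⟩ := map_Zstar_Tstar hq hσ hX hindep hlaw hV hnull htest
  set r := dfStar q V (final C) / df q V (final C)
  have hD := measurableSet_reconstruct (J := J) hinit r C
  have hZ : Measurable fun ω => Zstar V (final C) (X ω) := by
    have h := (measurable_Zstar (V := V) (c := final C)).comp hX
    simp only [Function.comp_def] at h
    exact h
  have hT : Measurable fun ω => Tstar V (final C) (X ω) := by
    have h := (measurable_Tstar (V := V) (c := final C)).comp hX
    simp only [Function.comp_def] at h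
    exact h
  -- Since the data equal the reconstruction at `T*`, the selection event is a condition on the pair
  -- `(Z*, T*)` alone.
  have hsel : ∀ᵐ ω ∂P, kmeans init J (X ω) = C ↔
      (Zstar V (final C) (X ω), Tstar V (final C) (X ω)) ∈ {p : (Matrix (Fin n) (Fin q) ℝ ×
        Matrix (Fin n) (Fin q) ℝ × ℝ × Matrix (Fin n) (Fin q) ℝ) × ℝ |
          0 ≤ p.2 ∧ C = kmeans init J (reconstruct r p.1 p.2)} := by
    filter_upwards [hne] with ω hω
    have hx := xstar_Tstar hd hd' hω.1 hω.2
    rw [xstar_eq_reconstruct] at hx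
    rw [hx]
    exact ⟨fun h => ⟨Tstar_nonneg hd.le hd'.le, h.symm⟩, fun h => h.2.symm⟩
  have hYm := measurable_condRV (J := J) (V := V) hX hinit
  have hTm := measurable_TstarRV (J := J) (V := V) hX hinit
  have h := condDistrib_of_selection (k := fun ω => kmeans init J (X ω)) hYm hTm (fun ω => rfl)
    hZ hT (fun ω h => by simp only [condRV, h]) (fun ω h => by simp only [TstarRV, h]) hjoint hD
    hsel
  exact h

end Main
end ClusterInference

theorem mainTheorem4
    {Ω : Type*} [MeasurableSpace Ω] (P : Measure Ω) [IsProbabilityMeasure P]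
    {n q K : ℕ} [NeZero K] (hq : 0 < q)
    (μ : Matrix (Fin n) (Fin q) ℝ) (σ : ℝ) (hσ : 0 < σ)
    (X : Ω → Matrix (Fin n) (Fin q) ℝ) (hX : Measurable X)
    (hindep : iIndepFun (fun i ω => X ω i) P)
    (hlaw : ∀ i, HasLaw (fun ω => WithLp.toLp 2 (X ω i))
      (multivariateGaussian (WithLp.toLp 2 (μ i)) (σ ^ 2 • (1 : Matrix (Fin q) (Fin q) ℝ))) P)
    (init : Matrix (Fin n) (Fin q) ℝ → Matrix (Fin K) (Fin q) ℝ) (hinit : Measurable init)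
    (J : ℕ) (V : Finset (Fin K × Fin K)) (hV : ∀ p ∈ V, p.1 < p.2) :
    (∀ᵐ ω ∂P, NullHyp μ V (final (kmeans init J (X ω))) →
      Testable V (final (kmeans init J (X ω))) →
        condLaw P init J V X ω =
          ProbabilityTheory.cond
            (FDist (df q V (final (kmeans init J (X ω)))) (dfStar q V (final (kmeans init J (X ω)))))
            (Sstar init J V (X ω))) ∧
    (∀ C : Fin (J + 1) → Fin n → Fin K, P {ω | kmeans init J (X ω) = C} ≠ 0 →
      NullHyp μ V (final C) → Testable V (final C) →
        pdf.IsUniform (pstar P init J V X) (Set.Icc 0 1)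
          (ProbabilityTheory.cond P {ω | kmeans init J (X ω) = C}) volume ∧
        ∀ α ∈ Set.Icc (0 : ℝ) 1,
          ProbabilityTheory.cond P {ω | kmeans init J (X ω) = C} {ω | pstar P init J V X ω ≤ α} =
            ENNReal.ofReal α) := by
  have hYm := measurable_condRV (J := J) (V := V) hX hinit
  have hTm := measurable_TstarRV (J := J) (V := V) hX hinit
  constructor
  -- The outcomes are finite in number, so the exceptional null sets for fixed `C` can be united.
  · have h : ∀ C : Fin (J + 1) → Fin n → Fin K, ∀ᵐ ω ∂P, kmeans init J (X ω) = C →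
        NullHyp μ V (final C) → Testable V (final C) → condLaw P init J V X ω =
          ProbabilityTheory.cond (FDist (df q V (final C)) (dfStar q V (final C)))
            (Sstar init J V (X ω)) := by
      intro C
      by_cases hC : NullHyp μ V (final C) ∧ Testable V (final C)
      · filter_upwards [ae_of_ae_map hYm.aemeasurable
          (condDistrib_TstarRV hq hσ hX hindep hlaw hinit hV C hC.1 hC.2)] with ω hω hk _ _
        subst hk
        exact hω rfl
      · exact Filter.Eventually.of_forall fun ω _ h1 h2 => absurd ⟨h1, h2⟩ hC
    filter_upwards [ae_all_iff.2 h] with ω hω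
    exact hω _ rfl
  · intro C hC hnull htest
    have hfd := nullSingletonClass_FDist (df_pos hq hV htest) (dfStar_pos hq htest)
    have hatom : ∀ᵐ y ∂(P.map (condRV init J V X)), y ∈ Prod.fst ⁻¹' {C} →
        NullSingletonClass (condDistrib (TstarRV init J V X) (condRV init J V X) P y) := by
      filter_upwards [condDistrib_TstarRV hq hσ hX hindep hlaw hinit hV C hnull htest] with y hy h
      rw [hy h]
      -- A truncation is absolutely continuous with respect to the `F` law and inherits the absence
      -- of atoms.
      exact ⟨fun t => (cond_absolutelyContinuous (measure_singleton t))⟩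
    have hmap : (ProbabilityTheory.cond P {ω | kmeans init J (X ω) = C}).map
        (pstar P init J V X) = volume.restrict (Set.Icc 0 1) :=
      map_cond_one_sub_cdf hYm hTm (compProd_map_condDistrib hTm.aemeasurable)
        (measurable_fst (measurableSet_singleton C)) hC hatom
    have hpm : Measurable (pstar P init J V X) :=
      by
      have h := (measurable_cdf_kernel (κ := condDistrib (TstarRV init J V X)
        (condRV init J V X) P)).comp (hYm.prodMk hTm)
      simp only [Function.comp_def] at h
      exact measurable_const.sub h
    refine ⟨?_, fun α hα => ?_⟩
    · rw [pdf.IsUniform, hmap, ProbabilityTheory.cond]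
      simp
    · have h := congrArg (fun m => m (Set.Iic α)) hmap
      simp only [Measure.map_apply hpm measurableSet_Iic,
        Measure.restrict_apply measurableSet_Iic] at h
      have hset : Set.Iic α ∩ Set.Icc 0 1 = Set.Icc 0 α := by
        ext t
        simp only [Set.mem_inter_iff, Set.mem_Iic, Set.mem_Icc]
        exact ⟨fun h => ⟨h.2.1, h.1⟩, fun h => ⟨h.2, h.1, h.2.trans hα.2⟩⟩
      rw [hset, Real.volume_Icc, sub_zero] at h
      exact h
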